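/- **Setting.** Literals are atoms $a$ or negated atoms $\neg a$. A rule $r$ has a set $H(r)$ of head literals, a positive body $B^+(r)$ and a default-negated body $B^-(r)$; a set $X$ of literals *defeats* $r$ if $X\cap B^-(r)\neq\emptyset$. $\mathcal{AS}(Q)$ denotes the set of consistent answer sets of a program $Q$ (Gelfond–Lifschitz); for a function-free first-order program these are the answer sets of its ground instantiation over its Herbrand universe, a comparison $X<Y$ in a body being evaluated in a fixed total order on the constants. For a program $P$, $B_P$ is the set of all literals over the atoms of $P$. A *prioritized program* is a pair $\mathcal P=(P,<)$ of a finite propositional program $P$, each rule of which has exactly one head literal, and a strict partial order $<$ on $P$ ($r<r'$: $r$ has higher priority). A *full prioritization* of $\mathcal P$ is $(P,<')$ with $<'$ a total order refining $<$; $\mathcal P$ is *fully prioritized* if it is its only full prioritization. If $\mathcal P=\{r_1<\dots<r_n\}$ is fully prioritized and all $B^+(r_i)$ are empty, then for a set $S$ of literals put $S_0=\emptyset$, $S_i=S_{i-1}$ if $S_{i-1}$ defeats $r_i$ or ($H(r_i)\subseteq S$ and $S$ defeats $r_i$), and $S_i=S_{i-1}\cup H(r_i)$ otherwise; let $C_{\mathcal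 P}(S)=S_n$ if $S_n$ is consistent, and $C_{\mathcal P}(S)=B_P$ otherwise. In this case $A\in\mathcal{AS}(P)$ is *B-preferred* iff $C_{\mathcal P}(A)=A$. For a general fully prioritized $\mathcal P$, $A\in\mathcal{AS}(P)$ is B-preferred iff it is a B-preferred answer set of the dual reduct of $\mathcal P$ with respect to $A$, obtained by deleting all rules with $B^+(r)\not\subseteq A$ and all positive body literals of the remaining rules, each resulting rule inheriting the priority of the first remaining rule that yields it. For any other $\mathcal P$, $A\in\mathcal{AS}(P)$ is B-preferred iff it is B-preferred for some full prioritization of $\mathcal P$. $\mathcal{BPAS}(\mathcal P)$ is the set of B-preferred answer sets of $\mathcal P$. **Encoding.** Literals and the rules of $P$ are named by distinct constants. $F(\mathcal P)$ consists of the facts $rule(r)$, $head(c,r)$ for $c\in H(r)$, $pbl(a,r)$ for $a\in B^+(r)$ and $nbl(b,r)$ for $b\in B^-(r)$, for every $r\in P$; $compl(a,\neg a)$ for every atom $a$ such that both $a$ and $\neg a$ occur in $P$; and $pr(r,r')$ for every pair $(r,r')$ in the transitive reduction of $<$. The meta-program $P_{I_g}$ consists of the following rules. ``` in_AS(X) :-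 head(X,R), pos_body_true(R), not neg_body_false(R). pos_body_exists(R) :- pbl(X,R). pos_body_true(R) :- rule(R), not pos_body_exists(R). pbl_inbetween(X,Y,R) :- pbl(X,R), pbl(Y,R), pbl(Z,R), X < Z, Z < Y. pbl_notlast(X,R) :- pbl(X,R), pbl(Y,R), X < Y. pbl_notfirst(X,R) :- pbl(X,R), pbl(Y,R), Y < X. pos_body_true_upto(R,X) :- pbl(X,R), not pbl_notfirst(X,R), in_AS(X). pos_body_true_upto(R,X) :- pos_body_true_upto(R,Y), pbl(X,R), in_AS(X), Y < X, not pbl_inbetween(Y,X,R). pos_body_true(R) :- pos_body_true_upto(R,X), not pbl_notlast(X,R). neg_body_false(Y) :- nbl(X,Y), in_AS(X). :- compl(X,Y), in_AS(X), in_AS(Y). g(R) :- rule(R), not neg_body_false(R), pos_body_true(R). z(R) :- rule(R), pos_body_true(R), head(X,R), not in_AS(X). stage(S) :- rule(S). nosource0(R) :- pr(R1,R). remove(R,S) :- rule(R), not nosource0(R), not z(R), stage(S). nosource(R,S) :- pr(R1,R), stage(S), not remove(R1,S). remove(R,S1) :- rule(R), not nosource(R,S), stage(S), stage(S1), S < S1,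 not z(R), not remove(R,S). remove(R,S1) :- rule(R), not nosource(R,S), stage(S), stage(S1), S < S1, z(R), nbl(X,R), s(X,S). s(X,St) :- remove(R,St), g(R), head(X,R). removed(R) :- remove(R,S). :- rule(R), not removed(R). ``` Let $\pi(A)=\{\ell \mid in\_AS(\ell)\in A\}$. **Theorem.** Let $\mathcal P=(P,<)$ be a propositional prioritized program. Then (i) if $A\in\mathcal{AS}(P_{I_g}\cup F(\mathcal P))$, then $\pi(A)\in\mathcal{BPAS}(\mathcal P)$; and (ii) for each $A\in\mathcal{BPAS}(\mathcal P)$ there exists some $A'\in\mathcal{AS}(P_{I_g}\cup F(\mathcal P))$ such that $\pi(A')=A$. -/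

import Mathlib

namespace MetaASP

/-! ### Classical literals, rules, and answer sets of ground programs -/

/-- Classical literals over a set of atoms: an atom or a (strongly) negated atom. -/
inductive Lit (α : Type*) where
  | pos : α → Lit α
  | neg : α → Lit α

namespace Lit

/-- The atom underlying a literal. -/
def atom {α : Type*} : Lit α → α
  | pos a => a
  | neg a => a

/-- The complementary literal. -/
def compl {α : Type*} : Lit α → Lit α
  | pos a => neg a
  | neg a => pos a

/-- Apply a map of atoms to a literal. -/
def map {α β : Type*} (f : α → β) : Lit α → Lit β
  | pos a => pos (f a)
  | neg a => neg (f a)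

end Lit

/-- A ground rule `h₁ v ... v hₙ :- p₁, ..., pₖ, not q₁, ..., not qₘ`. -/
structure Rule (α : Type*) where
  head : List (Lit α)
  pos : List (Lit α)
  neg : List (Lit α)

namespace Rule

variable {α : Type*}

/-- The set `H(r)` of head literals. -/
def H (r : Rule α) : Set (Lit α) := {l | l ∈ r.head}

/-- The set `B⁺(r)` of positive body literals. -/
def Bpos (r : Rule α) : Set (Lit α) := {l | l ∈ r.pos}

/-- The set `B⁻(r)` of negative (default-negated) body literals. -/
def Bneg (r : Rule α) : Set (Lit α) := {l | l ∈ r.neg}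

/-- All literals occurring in a rule. -/
def lits (r : Rule α) : Set (Lit α) := r.H ∪ r.Bpos ∪ r.Bneg

/-- A set of literals defeats a rule if it meets the negative body. -/
def DefeatedBy (r : Rule α) (X : Set (Lit α)) : Prop := (X ∩ r.Bneg).Nonempty

/-- Delete all negative body literals. -/
def dropNeg (r : Rule α) : Rule α := ⟨r.head, r.pos, []⟩

/-- Delete all positive body literals. -/
def dropPos (r : Rule α) : Rule α := ⟨r.head, [], r.neg⟩

end Rule

section Ground

variable {α : Type*}

/-- The literals occurring in a ground program. -/
def occurring (P : Set (Rule α)) : Set (Lit α) := {l | ∃ r ∈ P, l ∈ r.lits}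

/-- `B_P` for a propositional program: all classical literals over the atoms occurring in `P`. -/
def base (P : Set (Rule α)) : Set (Lit α) := {l | ∃ k ∈ occurring P, k.atom = l.atom}

/-- No literal of `I` has its complement in `I`. -/
def Consistent (I : Set (Lit α)) : Prop := I ∩ Lit.compl '' I = ∅

/-- `I` is closed under a positive ground program. Integrity constraints (empty head) are
violated as soon as their body holds. -/
def ClosedUnder (I : Set (Lit α)) (P : Set (Rule α)) : Prop :=
  ∀ r ∈ P, r.Bpos ⊆ I → (r.H ∩ I).Nonempty

/-- The Gelfond-Lifschitz reduct of a ground program. -/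
def reduct (P : Set (Rule α)) (I : Set (Lit α)) : Set (Rule α) :=
  {r' | ∃ r ∈ P, ¬ r.DefeatedBy I ∧ r' = r.dropNeg}

/-- Answer sets of a positive ground program over the literal base `B`: the minimal
consistent interpretations closed under the program. -/
def IsAnswerSetOfPositive (B : Set (Lit α)) (P : Set (Rule α)) (I : Set (Lit α)) : Prop :=
  Minimal (fun X => X ⊆ B ∧ Consistent X ∧ ClosedUnder X P) I

/-- Consistent answer sets of a ground program over the literal base `B`. -/
def IsAnswerSet (B : Set (Lit α)) (P : Set (Rule α)) (I : Set (Lit α)) : Prop :=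
  IsAnswerSetOfPositive B (reduct P I) I

/-- The answer sets of a propositional program. -/
def AS (P : Set (Rule α)) : Set (Set (Lit α)) := {I | IsAnswerSet (base P) P I}

end Ground

/-! ### Prioritized programs and B-preferred answer sets -/

/-- A prioritized propositional program: a finite normal program without integrity
constraints (every head consists of exactly one literal), together with a strict partial order
on its rules; `lt r r'` says that `r` has higher priority than `r'`. -/
structure PrioritizedProgram (α : Type*) where
  rules : Set (Rule α)
  finite : rules.Finite
  normal : ∀ r ∈ rules, ∃ c, r.H = {c}
  lt : Rule α → Rule α → Prop
  lt_mem : ∀ {r r'}, lt r r' → r ∈ rules ∧ r' ∈ rules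
  irrefl : ∀ r, ¬ lt r r
  trans : ∀ {r r' r''}, lt r r' → lt r' r'' → lt r r''

namespace PrioritizedProgram

variable {α : Type*}

/-- The full prioritizations of `P`: the same rules, with a total order refining that of `P`. -/
def FP (P : PrioritizedProgram α) : Set (PrioritizedProgram α) :=
  {Q | Q.rules = P.rules ∧
    (∀ r ∈ Q.rules, ∀ r' ∈ Q.rules, r ≠ r' → Q.lt r r' ∨ Q.lt r' r) ∧
    ∀ r r', P.lt r r' → Q.lt r r'}

/-- `P` is its own and only full prioritization. -/
def FullyPrioritized (P : PrioritizedProgram α) : Prop := P.FP = {P}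

/-- `L = [r₁, ..., rₙ]` lists the rules of `P` such that `rᵢ < rⱼ` for `i < j`.
Such a list is unique, and it exists exactly if the order is total. -/
def IsEnumeration (P : PrioritizedProgram α) (L : List (Rule α)) : Prop :=
  (∀ r, r ∈ L ↔ r ∈ P.rules) ∧ L.Pairwise P.lt

/-- Every rule has an empty positive body. -/
def PrerequisiteFree (P : PrioritizedProgram α) : Prop := ∀ r ∈ P.rules, r.Bpos = ∅

/-- `r` survives the first step of the dual reduct w.r.t. `X`, is mapped to `r'` by the second
step, and is the first such rule of `P`. -/
def IsFirst (P : PrioritizedProgram α) (X : Set (Lit α)) (r' r : Rule α) : Prop :=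
  (r ∈ P.rules ∧ r.Bpos ⊆ X ∧ r.dropPos = r') ∧
    ∀ q ∈ P.rules, q.Bpos ⊆ X → q.dropPos = r' → q ≠ r → P.lt r q

theorem IsFirst.unique {P : PrioritizedProgram α} {X : Set (Lit α)} {r' r q : Rule α}
    (hr : P.IsFirst X r' r) (hq : P.IsFirst X r' q) : r = q := by
  by_contra hne
  have h1 := hr.2 q hq.1.1 hq.1.2.1 hq.1.2.2 (fun h => hne h.symm)
  have h2 := hq.2 r hr.1.1 hr.1.2.1 hr.1.2.2 hne
  exact P.irrefl r (P.trans h1 h2)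

/-- The dual reduct of `P` w.r.t. `X`: delete the rules whose positive body is not contained in
`X` and all positive body literals of the others; a resulting rule inherits the priority of the
first rule from which it results. -/
def dualReduct (P : PrioritizedProgram α) (X : Set (Lit α)) : PrioritizedProgram α where
  rules := {r' | ∃ r ∈ P.rules, r.Bpos ⊆ X ∧ r.dropPos = r'}
  finite := (P.finite.image Rule.dropPos).subset (by
    rintro _ ⟨r, hr, -, rfl⟩
    exact ⟨r, hr, rfl⟩)
  normal := by
    rintro _ ⟨r, hr, -, rfl⟩
    exact P.normal r hr
  lt := fun r₁' r₂' => ∃ r₁ r₂, P.IsFirst X r₁' r₁ ∧ P.IsFirst X r₂' r₂ ∧ P.lt r₁ r₂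
  lt_mem := by
    rintro _ _ ⟨r₁, r₂, h₁, h₂, -⟩
    exact ⟨⟨r₁, h₁.1⟩, ⟨r₂, h₂.1⟩⟩
  irrefl := by
    rintro _ ⟨r₁, r₂, h₁, h₂, h⟩
    rw [h₁.unique h₂] at h
    exact P.irrefl _ h
  trans := by
    rintro _ _ _ ⟨r₁, r₂, h₁, h₂, h⟩ ⟨q₁, q₂, k₁, k₂, k⟩
    rw [← h₂.unique k₁] at k
    exact ⟨r₁, q₂, h₁, k₂, P.trans h k⟩

end PrioritizedProgram

section Preferred

variable {α : Type*}

open Classical in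
/-- One step `S_{i-1} ↦ S_i` of the construction of `C_P(S)`, for the rule `r = r_i`. -/
noncomputable def step (S : Set (Lit α)) (Sprev : Set (Lit α)) (r : Rule α) : Set (Lit α) :=
  if r.DefeatedBy Sprev ∨ (r.H ⊆ S ∧ r.DefeatedBy S) then Sprev else Sprev ∪ r.H

open Classical in
/-- The operator `C_P(S)` for a fully prioritized prerequisite-free program
`P = {r₁, ..., rₙ}`, given as the list of its rules in order of priority. -/
noncomputable def C (L : List (Rule α)) (S : Set (Lit α)) : Set (Lit α) :=
  if Consistent (L.foldl (step S) ∅) then L.foldl (step S) ∅ else base {r | r ∈ L}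

/-- B-preferred answer sets of fully prioritized prerequisite-free programs. -/
def IsBPrefPrereqFree (P : PrioritizedProgram α) (A : Set (Lit α)) : Prop :=
  P.FullyPrioritized ∧ P.PrerequisiteFree ∧ A ∈ AS P.rules ∧
    ∃ L, P.IsEnumeration L ∧ C L A = A

/-- B-preferred answer sets of fully prioritized programs. -/
def IsBPrefFull (P : PrioritizedProgram α) (A : Set (Lit α)) : Prop :=
  P.FullyPrioritized ∧ A ∈ AS P.rules ∧ IsBPrefPrereqFree (P.dualReduct A) A

/-- The set of all B-preferred answer sets of a prioritized program. -/
def BPAS (P : PrioritizedProgram α) : Set (Set (Lit α)) :=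
  {A | A ∈ AS P.rules ∧
    ((P.FullyPrioritized ∧ IsBPrefFull P A) ∨
      (¬ P.FullyPrioritized ∧ ∃ Q ∈ P.FP, IsBPrefFull Q A))}

end Preferred

/-! ### Function-free first-order programs with a built-in order on constants -/

/-- Terms over variables `V` and constants `K`. -/
inductive Term (V K : Type*) where
  | var : V → Term V K
  | const : K → Term V K

/-- Atoms with predicate names from `σ` and arguments from `T`. A predicate symbol is a name
together with the number of its arguments. -/
structure Atom (σ T : Type*) where
  pred : σ
  args : List T

/-- A first-order rule; `less` lists the built-in comparisons `s < t` of its body. -/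
structure FORule (σ V K : Type*) where
  head : List (Lit (Atom σ (Term V K)))
  pos : List (Lit (Atom σ (Term V K)))
  neg : List (Lit (Atom σ (Term V K)))
  less : List (Term V K × Term V K)

section FirstOrder

variable {σ V K : Type*}

/-- The value of a term under a substitution of constants for variables. -/
def Term.subst (θ : V → K) : Term V K → K
  | var v => θ v
  | const c => c

/-- The ground instance of a literal. -/
def groundLit (θ : V → K) (l : Lit (Atom σ (Term V K))) : Lit (Atom σ K) :=
  l.map fun a => ⟨a.pred, a.args.map (Term.subst θ)⟩

/-- The ground instance of a rule (without its built-in comparisons). -/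
def FORule.inst (r : FORule σ V K) (θ : V → K) : Rule (Atom σ K) :=
  ⟨r.head.map (groundLit θ), r.pos.map (groundLit θ), r.neg.map (groundLit θ)⟩

/-- The literals occurring in a first-order program. -/
def foOccurring (Q : Set (FORule σ V K)) : Set (Lit (Atom σ (Term V K))) :=
  {l | ∃ r ∈ Q, l ∈ r.head ∨ l ∈ r.pos ∨ l ∈ r.neg}

/-- The constants occurring in a first-order program. -/
def constants (Q : Set (FORule σ V K)) : Set K :=
  {c | (∃ l ∈ foOccurring Q, Term.const c ∈ l.atom.args) ∨
    ∃ r ∈ Q, ∃ p ∈ r.less, p.1 = Term.const c ∨ p.2 = Term.const c}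

open Classical in
/-- The Herbrand universe: the constants of the program, or one arbitrary constant if there are
none. -/
noncomputable def herbrandUniverse [Nonempty K] (Q : Set (FORule σ V K)) : Set K :=
  if (constants Q).Nonempty then constants Q else {Classical.arbitrary K}

/-- The ground literals over the predicate symbols of the program and its Herbrand universe. -/
def foBase [Nonempty K] (Q : Set (FORule σ V K)) : Set (Lit (Atom σ K)) :=
  {l | (∃ k ∈ foOccurring Q,
      k.atom.pred = l.atom.pred ∧ k.atom.args.length = l.atom.args.length) ∧
    ∀ c ∈ l.atom.args, c ∈ herbrandUniverse Q}

/-- The ground instantiation over the Herbrand universe. Built-in comparisons are evaluated in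
the total order on constants: the instances in which they all hold are kept, the others have a
false body. -/
def ground [Nonempty K] [LinearOrder K] (Q : Set (FORule σ V K)) : Set (Rule (Atom σ K)) :=
  {r' | ∃ r ∈ Q, ∃ θ : V → K, (∀ v, θ v ∈ herbrandUniverse Q) ∧
    (∀ p ∈ r.less, p.1.subst θ < p.2.subst θ) ∧ r' = r.inst θ}

/-- The answer sets of a first-order program. -/
def foAS [Nonempty K] [LinearOrder K] (Q : Set (FORule σ V K)) : Set (Set (Lit (Atom σ K))) :=
  {I | IsAnswerSet (foBase Q) (ground Q) I}

end FirstOrder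

/-! ### The meta-program -/

/-- The predicate names of the meta-program. -/
inductive MetaPred where
  | rule | head | pbl | nbl | compl | pr
  | in_AS | pos_body_exists | pos_body_true | pos_body_true_upto
  | pbl_inbetween | pbl_notlast | pbl_notfirst | neg_body_false
  | g | z | stage | nosource0 | nosource | remove | s | removed

/-- The variables of the meta-program. -/
inductive Var where
  | X | Y | Z | R | R1 | S | S1 | St

section Meta

variable {K : Type*}

/-- A positive literal whose arguments are variables. -/
def lit (p : MetaPred) (xs : List Var) : Lit (Atom MetaPred (Term Var K)) :=
  .pos ⟨p, xs.map Term.var⟩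

/-- The built-in comparison `x < y` between variables. -/
def lessVar (x y : Var) : Term Var K × Term Var K := (.var x, .var y)

open MetaPred Var

/-- The meta-interpreter for answer sets. Each entry lists the head, the positive body, the
default-negated body, and the built-in comparisons. -/
def PIa : List (FORule MetaPred Var K) := [
  ⟨[lit in_AS [X]], [lit head [X, R], lit pos_body_true [R]], [lit neg_body_false [R]], []⟩,
  ⟨[lit pos_body_exists [R]], [lit pbl [X, R]], [], []⟩,
  ⟨[lit pos_body_true [R]], [lit rule [R]], [lit pos_body_exists [R]], []⟩,
  ⟨[lit pbl_inbetween [X, Y, R]], [lit pbl [X, R], lit pbl [Y, R], lit pbl [Z, R]], [],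
    [lessVar X Z, lessVar Z Y]⟩,
  ⟨[lit pbl_notlast [X, R]], [lit pbl [X, R], lit pbl [Y, R]], [], [lessVar X Y]⟩,
  ⟨[lit pbl_notfirst [X, R]], [lit pbl [X, R], lit pbl [Y, R]], [], [lessVar Y X]⟩,
  ⟨[lit pos_body_true_upto [R, X]], [lit pbl [X, R], lit in_AS [X]],
    [lit pbl_notfirst [X, R]], []⟩,
  ⟨[lit pos_body_true_upto [R, X]],
    [lit pos_body_true_upto [R, Y], lit pbl [X, R], lit in_AS [X]],
    [lit pbl_inbetween [Y, X, R]], [lessVar Y X]⟩,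
  ⟨[lit pos_body_true [R]], [lit pos_body_true_upto [R, X]], [lit pbl_notlast [X, R]], []⟩,
  ⟨[lit neg_body_false [Y]], [lit nbl [X, Y], lit in_AS [X]], [], []⟩,
  ⟨[], [lit compl [X, Y], lit in_AS [X], lit in_AS [Y]], [], []⟩]

/-- The part of the meta-program that performs the deterministic graph-based check. -/
def PIgCheck : List (FORule MetaPred Var K) := [
  ⟨[lit g [R]], [lit rule [R], lit pos_body_true [R]], [lit neg_body_false [R]], []⟩,
  ⟨[lit z [R]], [lit rule [R], lit pos_body_true [R], lit head [X, R]], [lit in_AS [X]], []⟩,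
  ⟨[lit stage [S]], [lit rule [S]], [], []⟩,
  ⟨[lit nosource0 [R]], [lit pr [R1, R]], [], []⟩,
  ⟨[lit remove [R, S]], [lit rule [R], lit stage [S]], [lit nosource0 [R], lit z [R]], []⟩,
  ⟨[lit nosource [R, S]], [lit pr [R1, R], lit stage [S]], [lit remove [R1, S]], []⟩,
  ⟨[lit remove [R, S1]], [lit rule [R], lit stage [S], lit stage [S1]],
    [lit nosource [R, S], lit z [R], lit remove [R, S]], [lessVar S S1]⟩,
  ⟨[lit remove [R, S1]],
    [lit rule [R], lit stage [S], lit stage [S1], lit z [R], lit nbl [X, R], lit s [X, S]],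
    [lit nosource [R, S]], [lessVar S S1]⟩,
  ⟨[lit s [X, St]], [lit remove [R, St], lit g [R], lit head [X, R]], [], []⟩,
  ⟨[lit removed [R]], [lit remove [R, S]], [], []⟩,
  ⟨[], [lit rule [R]], [lit removed [R]], []⟩]

/-- The complete meta-program `P_{I_g}`. -/
def PIg : Set (FORule MetaPred Var K) := {r | r ∈ PIa ∨ r ∈ PIgCheck}

/-- The ground fact `p(cs)`. -/
def fact (p : MetaPred) (cs : List K) : FORule MetaPred Var K :=
  ⟨[.pos ⟨p, cs.map Term.const⟩], [], [], []⟩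

variable {α : Type*}

/-- The facts `F(P)` representing a propositional program, where `litC` and `ruleId` give the
constants that name literals and rules. -/
def factsOfProgram (litC : Lit α → K) (ruleId : Rule α → K) (P : Set (Rule α)) :
    Set (FORule MetaPred Var K) :=
  {f | (∃ r ∈ P,
      f = fact MetaPred.rule [ruleId r] ∨
      (∃ l ∈ r.H, f = fact MetaPred.head [litC l, ruleId r]) ∨
      (∃ l ∈ r.Bpos, f = fact MetaPred.pbl [litC l, ruleId r]) ∨
      (∃ l ∈ r.Bneg, f = fact MetaPred.nbl [litC l, ruleId r])) ∨
    ∃ a : α, Lit.pos a ∈ occurring P ∧ Lit.neg a ∈ occurring P ∧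
      f = fact MetaPred.compl [litC (.pos a), litC (.neg a)]}

/-- The pairs of the transitive reduction of the (finite) strict partial order of `P`. -/
def Covers (P : PrioritizedProgram α) (r r' : Rule α) : Prop :=
  P.lt r r' ∧ ¬ ∃ q, P.lt r q ∧ P.lt q r'

/-- The facts `F(P)` representing a prioritized program. -/
def facts (litC : Lit α → K) (ruleId : Rule α → K) (P : PrioritizedProgram α) :
    Set (FORule MetaPred Var K) :=
  factsOfProgram litC ruleId P.rules ∪
    {f | ∃ r r', Covers P r r' ∧ f = fact MetaPred.pr [ruleId r, ruleId r']}

/-- The projection `π(A) = {ℓ | in_AS(ℓ) ∈ A}`. -/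
def proj (litC : Lit α → K) (A : Set (Lit (Atom MetaPred K))) : Set (Lit α) :=
  {l | Lit.pos ⟨MetaPred.in_AS, [litC l]⟩ ∈ A}

end Meta

end MetaASP

set_option linter.unusedSectionVars false

namespace MetaASP

/-! ### Ground consequences of the meta-program as an inductive predicate. -/

section Derivation

variable {α K : Type*} [LinearOrder K]

/-! Both sides of the correspondence are reduced to a condition on an answer set `A` of `P`. Call a
rule generating if its positive body holds in `A` and `A` does not defeat it, and a zombie if its
positive body holds in `A` but its head does not. For a total order, `A` is B-preferred iff every
zombie is defeated by the head of a generating rule of higher priority (`IsTotal.isBPrefFull_iff`).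
Indeed, the operator reproduces `A` exactly when it skips the rules that `A` defeats; for rules with
head in `A` this is built into its definition, and a zombie is skipped only if an earlier generating
rule has already defeated it. So `A` is B-preferred for a partial order iff some total refinement
has this property.

On the meta side, an answer set is a set of atoms `M` that is the least set closed under the ground
rules with negation evaluated in `M` itself, and that satisfies the constraints (`mem_foAS_iff`).
Its `in_AS` part is an answer set of `P`: the auxiliary predicates walk through each positive body
in the order of the constants and so decide whether it holds (`IsLeastDer.bodyMeaning`).

Soundness: every rule is removed at some stage. Rank each rule by its first such stage. A rule is
removed only after its immediate predecessors, and a zombie only after a generating rule that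
defeats it, so sorting by rank gives a suitable refinement.

Completeness: given a suitable refinement, there are as many stages as rules, and the rule at
position `i` can be removed at the `i`-th stage (`exists_removal`). The meta answer set itself is
obtained without guessing a fixpoint: negation is evaluated in an interpretation `intended` read off
from `A`, the least closed set relative to it is taken, and that set is shown to agree with
`intended` on all negated predicates (`IsLeastDer.negAgree_intended`), hence to be least relative to
itself. -/

/-- One-step consequences of the ground meta-program: positive body atoms are evaluated in `T`,
default-negated ones in `N`. -/
inductive Der (litC : Lit α → K) (ruleId : Rule α → K) (P : PrioritizedProgram α)
    (N T : MetaPred → List K → Prop) : MetaPred → List K → Prop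
  | rule {k : K} : (∃ q ∈ P.rules, k = ruleId q) → Der litC ruleId P N T .rule [k]
  | head {x k : K} : (∃ q ∈ P.rules, ∃ l ∈ q.H, x = litC l ∧ k = ruleId q) →
      Der litC ruleId P N T .head [x, k]
  | pbl {x k : K} : (∃ q ∈ P.rules, ∃ l ∈ q.Bpos, x = litC l ∧ k = ruleId q) →
      Der litC ruleId P N T .pbl [x, k]
  | nbl {x k : K} : (∃ q ∈ P.rules, ∃ l ∈ q.Bneg, x = litC l ∧ k = ruleId q) →
      Der litC ruleId P N T .nbl [x, k]
  | compl {x y : K} : (∃ a, Lit.pos a ∈ occurring P.rules ∧ Lit.neg a ∈ occurring P.rules ∧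
      x = litC (.pos a) ∧ y = litC (.neg a)) → Der litC ruleId P N T .compl [x, y]
  | pr {k k' : K} : (∃ q q', Covers P q q' ∧ k = ruleId q ∧ k' = ruleId q') →
      Der litC ruleId P N T .pr [k, k']
  | in_AS {x r : K} : T .head [x, r] → T .pos_body_true [r] → ¬ N .neg_body_false [r] →
      Der litC ruleId P N T .in_AS [x]
  | pos_body_exists {x r : K} : T .pbl [x, r] → Der litC ruleId P N T .pos_body_exists [r]
  | pos_body_true_empty {r : K} : T .rule [r] → ¬ N .pos_body_exists [r] →
      Der litC ruleId P N T .pos_body_true [r]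
  | pbl_inbetween {x y z r : K} : T .pbl [x, r] → T .pbl [y, r] → T .pbl [z, r] → x < z → z < y →
      Der litC ruleId P N T .pbl_inbetween [x, y, r]
  | pbl_notlast {x y r : K} : T .pbl [x, r] → T .pbl [y, r] → x < y →
      Der litC ruleId P N T .pbl_notlast [x, r]
  | pbl_notfirst {x y r : K} : T .pbl [x, r] → T .pbl [y, r] → y < x →
      Der litC ruleId P N T .pbl_notfirst [x, r]
  | upto_first {x r : K} : T .pbl [x, r] → T .in_AS [x] → ¬ N .pbl_notfirst [x, r] →
      Der litC ruleId P N T .pos_body_true_upto [r, x]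
  | upto_next {x y r : K} : T .pos_body_true_upto [r, y] → T .pbl [x, r] → T .in_AS [x] →
      ¬ N .pbl_inbetween [y, x, r] → y < x → Der litC ruleId P N T .pos_body_true_upto [r, x]
  | pos_body_true_last {x r : K} : T .pos_body_true_upto [r, x] → ¬ N .pbl_notlast [x, r] →
      Der litC ruleId P N T .pos_body_true [r]
  | neg_body_false {x y : K} : T .nbl [x, y] → T .in_AS [x] →
      Der litC ruleId P N T .neg_body_false [y]
  | g {r : K} : T .rule [r] → T .pos_body_true [r] → ¬ N .neg_body_false [r] →
      Der litC ruleId P N T .g [r]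
  | z {x r : K} : T .rule [r] → T .pos_body_true [r] → T .head [x, r] → ¬ N .in_AS [x] →
      Der litC ruleId P N T .z [r]
  | stage {s : K} : T .rule [s] → Der litC ruleId P N T .stage [s]
  | nosource0 {r1 r : K} : T .pr [r1, r] → Der litC ruleId P N T .nosource0 [r]
  | remove_source {r s : K} : T .rule [r] → T .stage [s] → ¬ N .nosource0 [r] → ¬ N .z [r] →
      Der litC ruleId P N T .remove [r, s]
  | nosource {r1 r s : K} : T .pr [r1, r] → T .stage [s] → ¬ N .remove [r1, s] →
      Der litC ruleId P N T .nosource [r, s]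
  | remove_next {r s s1 : K} : T .rule [r] → T .stage [s] → T .stage [s1] → ¬ N .nosource [r, s] →
      ¬ N .z [r] → ¬ N .remove [r, s] → s < s1 → Der litC ruleId P N T .remove [r, s1]
  | remove_zombie {x r s s1 : K} : T .rule [r] → T .stage [s] → T .stage [s1] → T .z [r] →
      T .nbl [x, r] → T .s [x, s] → ¬ N .nosource [r, s] → s < s1 →
      Der litC ruleId P N T .remove [r, s1]
  | s {x r st : K} : T .remove [r, st] → T .g [r] → T .head [x, r] →
      Der litC ruleId P N T .s [x, st]
  | removed {r s : K} : T .remove [r, s] → Der litC ruleId P N T .removed [r]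

variable {litC : Lit α → K} {ruleId : Rule α → K} {P : PrioritizedProgram α}

theorem Der.mono {N T T' : MetaPred → List K → Prop} (hT : ∀ p cs, T p cs → T' p cs)
    {p : MetaPred} {cs : List K} (h : Der litC ruleId P N T p cs) :
    Der litC ruleId P N T' p cs := by
  cases h with
  | rule h => exact .rule h
  | head h => exact .head h
  | pbl h => exact .pbl h
  | nbl h => exact .nbl h
  | compl h => exact .compl h
  | pr h => exact .pr h
  | in_AS h1 h2 h3 => exact .in_AS (hT _ _ h1) (hT _ _ h2) h3
  | pos_body_exists h => exact .pos_body_exists (hT _ _ h)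
  | pos_body_true_empty h1 h2 => exact .pos_body_true_empty (hT _ _ h1) h2
  | pbl_inbetween h1 h2 h3 h4 h5 =>
    exact .pbl_inbetween (hT _ _ h1) (hT _ _ h2) (hT _ _ h3) h4 h5
  | pbl_notlast h1 h2 h3 => exact .pbl_notlast (hT _ _ h1) (hT _ _ h2) h3
  | pbl_notfirst h1 h2 h3 => exact .pbl_notfirst (hT _ _ h1) (hT _ _ h2) h3
  | upto_first h1 h2 h3 => exact .upto_first (hT _ _ h1) (hT _ _ h2) h3
  | upto_next h1 h2 h3 h4 h5 => exact .upto_next (hT _ _ h1) (hT _ _ h2) (hT _ _ h3) h4 h5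
  | pos_body_true_last h1 h2 => exact .pos_body_true_last (hT _ _ h1) h2
  | neg_body_false h1 h2 => exact .neg_body_false (hT _ _ h1) (hT _ _ h2)
  | g h1 h2 h3 => exact .g (hT _ _ h1) (hT _ _ h2) h3
  | z h1 h2 h3 h4 => exact .z (hT _ _ h1) (hT _ _ h2) (hT _ _ h3) h4
  | stage h => exact .stage (hT _ _ h)
  | nosource0 h => exact .nosource0 (hT _ _ h)
  | remove_source h1 h2 h3 h4 => exact .remove_source (hT _ _ h1) (hT _ _ h2) h3 h4
  | nosource h1 h2 h3 => exact .nosource (hT _ _ h1) (hT _ _ h2) h3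
  | remove_next h1 h2 h3 h4 h5 h6 h7 =>
    exact .remove_next (hT _ _ h1) (hT _ _ h2) (hT _ _ h3) h4 h5 h6 h7
  | remove_zombie h1 h2 h3 h4 h5 h6 h7 h8 =>
    exact .remove_zombie (hT _ _ h1) (hT _ _ h2) (hT _ _ h3) (hT _ _ h4) (hT _ _ h5)
      (hT _ _ h6) h7 h8
  | s h1 h2 h3 => exact .s (hT _ _ h1) (hT _ _ h2) (hT _ _ h3)
  | removed h => exact .removed (hT _ _ h)

/-- `T` is closed under the one-step consequences relative to `N`. -/
def DerClosed (litC : Lit α → K) (ruleId : Rule α → K) (P : PrioritizedProgram α)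
    (N T : MetaPred → List K → Prop) : Prop :=
  ∀ p cs, Der litC ruleId P N T p cs → T p cs

/-- `T` is the least set of atoms closed under the one-step consequences relative to `N`. -/
structure IsLeastDer (litC : Lit α → K) (ruleId : Rule α → K) (P : PrioritizedProgram α)
    (N T : MetaPred → List K → Prop) : Prop where
  closed : DerClosed litC ruleId P N T
  least : ∀ U, DerClosed litC ruleId P N U → ∀ p cs, T p cs → U p cs

theorem IsLeastDer.iff {N T : MetaPred → List K → Prop} (h : IsLeastDer litC ruleId P N T)
    {p : MetaPred} {cs : List K} : T p cs ↔ Der litC ruleId P N T p cs :=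
  ⟨h.least _ (fun _ _ => Der.mono h.closed) p cs, h.closed p cs⟩

/-- The conjunction of `T` and `φ` is itself closed, so leastness applies to it. Keeping `T` in the
hypotheses lets the premises of a rule be interpreted by results already known for `T`. -/
theorem IsLeastDer.induct {N T : MetaPred → List K → Prop} (h : IsLeastDer litC ruleId P N T)
    (φ : MetaPred → List K → Prop)
    (hφ : ∀ p cs, Der litC ruleId P N (fun p cs => T p cs ∧ φ p cs) p cs → φ p cs)
    {p : MetaPred} {cs : List K} (hT : T p cs) : φ p cs :=
  (h.least (fun p cs => T p cs ∧ φ p cs)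
    (fun p cs hd => ⟨h.closed _ _ (hd.mono fun _ _ h => h.1), hφ p cs hd⟩) p cs hT).2

/-- The integrity constraints of the meta-program. -/
structure Constraints (N T : MetaPred → List K → Prop) : Prop where
  compl : ∀ x y, T .compl [x, y] → T .in_AS [x] → T .in_AS [y] → False
  removed : ∀ k, T .rule [k] → N .removed [k]

/-- The atoms whose positive literals belong to a set of ground literals. -/
def holds (I : Set (Lit (Atom MetaPred K))) (p : MetaPred) (cs : List K) : Prop :=
  Lit.pos ⟨p, cs⟩ ∈ I

/-- The set of positive literals over a set of atoms. -/
def posLits (M : MetaPred → List K → Prop) : Set (Lit (Atom MetaPred K)) :=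
  {l | ∃ p cs, l = .pos ⟨p, cs⟩ ∧ M p cs}

theorem holds_posLits (M : MetaPred → List K → Prop) : holds (posLits M) = M := by
  funext p cs
  simp [holds, posLits]

end Derivation

/-! ### From first-order rules and substitutions to one-step consequences, and back. -/

section Translation

variable {α K : Type*} [Nonempty K] [LinearOrder K]
variable {litC : Lit α → K} {ruleId : Rule α → K} {P : PrioritizedProgram α}

theorem herbrandUniverse_nonempty {σ V : Type*} (Q : Set (FORule σ V K)) :
    (herbrandUniverse Q).Nonempty := by
  unfold herbrandUniverse
  split_ifs with h
  · exact h
  · exact Set.singleton_nonempty _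

theorem constants_subset_herbrandUniverse {σ V : Type*} (Q : Set (FORule σ V K)) :
    constants Q ⊆ herbrandUniverse Q := by
  intro c hc
  unfold herbrandUniverse
  rw [if_pos ⟨c, hc⟩]
  exact hc

theorem mem_herbrandUniverse_of_fact {Q : Set (FORule MetaPred Var K)} {p : MetaPred}
    {cs : List K} (h : fact p cs ∈ Q) {c : K} (hc : c ∈ cs) : c ∈ herbrandUniverse Q := by
  apply constants_subset_herbrandUniverse
  refine Or.inl ⟨_, ⟨_, h, Or.inl (List.mem_singleton_self _)⟩, ?_⟩
  exact List.mem_map_of_mem hc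

theorem closedUnder_reduct_ground_iff {Q : Set (FORule MetaPred Var K)}
    {X I : Set (Lit (Atom MetaPred K))} :
    ClosedUnder X (reduct (ground Q) I) ↔
      ∀ r ∈ Q, ∀ θ : Var → K, (∀ v, θ v ∈ herbrandUniverse Q) →
        (∀ p ∈ r.less, p.1.subst θ < p.2.subst θ) →
        (∀ l ∈ r.pos, groundLit θ l ∈ X) → (∀ l ∈ r.neg, groundLit θ l ∉ I) →
        ∃ l ∈ r.head, groundLit θ l ∈ X := by
  constructor
  · intro h r hr θ hθ hless hpos hneg
    obtain ⟨l, hl, hlX⟩ := h (r.inst θ).dropNeg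
      ⟨r.inst θ, ⟨r, hr, θ, hθ, hless, rfl⟩, by
        rintro ⟨l, hlI, hl⟩
        obtain ⟨k, hk, rfl⟩ := List.mem_map.1 hl
        exact hneg k hk hlI, rfl⟩ (by
        intro l hl
        obtain ⟨k, hk, rfl⟩ := List.mem_map.1 hl
        exact hpos k hk)
    obtain ⟨k, hk, rfl⟩ := List.mem_map.1 hl
    exact ⟨k, hk, hlX⟩
  · rintro h _ ⟨_, ⟨r, hr, θ, hθ, hless, rfl⟩, hdef, rfl⟩ hpos
    obtain ⟨l, hl, hlX⟩ := h r hr θ hθ hless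
      (fun l hl => hpos (List.mem_map_of_mem hl))
      (fun l hl hlI => hdef ⟨_, hlI, List.mem_map_of_mem hl⟩)
    exact ⟨_, List.mem_map_of_mem hl, hlX⟩

theorem groundLit_lit (θ : Var → K) (p : MetaPred) (xs : List Var) :
    groundLit θ (lit p xs) = .pos ⟨p, xs.map θ⟩ := by
  simp only [groundLit, lit, Lit.map, List.map_map]
  rfl

theorem groundLit_fact (θ : Var → K) (p : MetaPred) (cs : List K) :
    groundLit θ (.pos ⟨p, cs.map Term.const⟩) = .pos ⟨p, cs⟩ := by
  simp only [groundLit, Lit.map, List.map_map]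
  congr 2
  exact List.map_id _

theorem subst_lessVar (θ : Var → K) (x y : Var) :
    (lessVar x y : Term Var K × Term Var K).1.subst θ < (lessVar x y).2.subst θ ↔ θ x < θ y :=
  Iff.rfl

theorem exists_eq_fact_of_mem_facts {f : FORule MetaPred Var K}
    (h : f ∈ facts litC ruleId P) :
    ∃ p cs, f = fact p cs ∧ ∀ N T, Der litC ruleId P N T p cs := by
  rcases h with (⟨q, hq, rfl | ⟨l, hl, rfl⟩ | ⟨l, hl, rfl⟩ | ⟨l, hl, rfl⟩⟩ | ⟨a, h1, h2, rfl⟩) |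
    ⟨q, q', h, rfl⟩
  · exact ⟨_, _, rfl, fun _ _ => .rule ⟨q, hq, rfl⟩⟩
  · exact ⟨_, _, rfl, fun _ _ => .head ⟨q, hq, l, hl, rfl, rfl⟩⟩
  · exact ⟨_, _, rfl, fun _ _ => .pbl ⟨q, hq, l, hl, rfl, rfl⟩⟩
  · exact ⟨_, _, rfl, fun _ _ => .nbl ⟨q, hq, l, hl, rfl, rfl⟩⟩
  · exact ⟨_, _, rfl, fun _ _ => .compl ⟨a, h1, h2, rfl, rfl⟩⟩
  · exact ⟨_, _, rfl, fun _ _ => .pr ⟨q, q', h, rfl, rfl⟩⟩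

variable (litC ruleId P) in
/-- The meta-program together with the facts that represent `P`. -/
abbrev program : Set (FORule MetaPred Var K) := PIg ∪ facts litC ruleId P

/-- The substitution with the given values. -/
def assign (x y z r r1 s s1 st : K) : Var → K
  | .X => x
  | .Y => y
  | .Z => z
  | .R => r
  | .R1 => r1
  | .S => s
  | .S1 => s1
  | .St => st

theorem assign_mem {x y z r r1 s s1 st : K} {H : Set K} (hx : x ∈ H) (hy : y ∈ H) (hz : z ∈ H)
    (hr : r ∈ H) (hr1 : r1 ∈ H) (hs : s ∈ H) (hs1 : s1 ∈ H) (hst : st ∈ H) (v : Var) :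
    assign x y z r r1 s s1 st v ∈ H := by
  cases v <;> assumption

theorem closedUnder_of_derClosed {X I : Set (Lit (Atom MetaPred K))}
    (hX : DerClosed litC ruleId P (holds I) (holds X)) (hc : Constraints (holds I) (holds X)) :
    ClosedUnder X (reduct (ground (program litC ruleId P)) I) := by
  rw [closedUnder_reduct_ground_iff]
  rintro r ((hr | hr) | hr) θ - hless hpos hneg
  · simp only [PIa, List.mem_cons, List.not_mem_nil, or_false] at hr
    rcases hr with rfl | rfl | rfl | rfl | rfl | rfl | rfl | rfl | rfl | rfl | rfl <;>
    simp only [List.mem_cons, List.not_mem_nil, or_false, forall_eq_or_imp, forall_eq, exists_eq_left,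
      groundLit_lit, List.map_cons, List.map_nil, subst_lessVar, false_imp_iff,
      implies_true, false_and, exists_false] at hpos hneg hless ⊢
    · exact hX _ _ (.in_AS hpos.1 hpos.2 hneg)
    · exact hX _ _ (.pos_body_exists hpos)
    · exact hX _ _ (.pos_body_true_empty hpos hneg)
    · exact hX _ _ (.pbl_inbetween hpos.1 hpos.2.1 hpos.2.2 hless.1 hless.2)
    · exact hX _ _ (.pbl_notlast hpos.1 hpos.2 hless)
    · exact hX _ _ (.pbl_notfirst hpos.1 hpos.2 hless)
    · exact hX _ _ (.upto_first hpos.1 hpos.2 hneg)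
    · exact hX _ _ (.upto_next hpos.1 hpos.2.1 hpos.2.2 hneg hless)
    · exact hX _ _ (.pos_body_true_last hpos hneg)
    · exact hX _ _ (.neg_body_false hpos.1 hpos.2)
    · exact hc.compl _ _ hpos.1 hpos.2.1 hpos.2.2
  · simp only [PIgCheck, List.mem_cons, List.not_mem_nil, or_false] at hr
    rcases hr with rfl | rfl | rfl | rfl | rfl | rfl | rfl | rfl | rfl | rfl | rfl <;>
    simp only [List.mem_cons, List.not_mem_nil, or_false, forall_eq_or_imp, forall_eq, exists_eq_left,
      groundLit_lit, List.map_cons, List.map_nil, subst_lessVar, false_imp_iff,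
      implies_true, false_and, exists_false] at hpos hneg hless ⊢
    · exact hX _ _ (.g hpos.1 hpos.2 hneg)
    · exact hX _ _ (.z hpos.1 hpos.2.1 hpos.2.2 hneg)
    · exact hX _ _ (.stage hpos)
    · exact hX _ _ (.nosource0 hpos)
    · exact hX _ _ (.remove_source hpos.1 hpos.2 hneg.1 hneg.2)
    · exact hX _ _ (.nosource hpos.1 hpos.2 hneg)
    · exact hX _ _ (.remove_next hpos.1 hpos.2.1 hpos.2.2 hneg.1 hneg.2.1 hneg.2.2 hless)
    · exact hX _ _ (.remove_zombie hpos.1 hpos.2.1 hpos.2.2.1 hpos.2.2.2.1 hpos.2.2.2.2.1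
        hpos.2.2.2.2.2 hneg hless)
    · exact hX _ _ (.s hpos.1 hpos.2.1 hpos.2.2)
    · exact hX _ _ (.removed hpos)
    · exact hneg (hc.removed _ hpos)
  · obtain ⟨p, cs, rfl, h⟩ := exists_eq_fact_of_mem_facts hr
    refine ⟨_, List.mem_singleton_self _, ?_⟩
    rw [groundLit_fact]
    exact hX _ _ (h _ _)

/-- Grounding admits only substitutions into the Herbrand universe, whereas `Der` ranges over all of
`K`. Being inside the base bridges the gap: the arguments of the positive premises, which all lie in
`X`, then belong to the universe. -/
theorem derClosed_of_closedUnder {X I : Set (Lit (Atom MetaPred K))}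
    (hB : X ⊆ foBase (program litC ruleId P))
    (h : ClosedUnder X (reduct (ground (program litC ruleId P)) I)) :
    DerClosed litC ruleId P (holds I) (holds X) ∧ Constraints (holds I) (holds X) := by
  rw [closedUnder_reduct_ground_iff] at h
  -- `d` is the value given to variables that do not occur in the rule at hand.
  obtain ⟨d, hd⟩ := herbrandUniverse_nonempty (program litC ruleId P)
  have hfact : ∀ p cs, fact p cs ∈ facts litC ruleId P → holds X p cs := by
    intro p cs hf
    obtain ⟨l, hl, hlX⟩ := h _ (Or.inr hf) (fun _ => d) (fun _ => hd) (by simp [fact])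
      (by simp [fact]) (by simp [fact])
    rw [List.mem_singleton.1 hl, groundLit_fact] at hlX
    exact hlX
  have ha : ∀ r : FORule MetaPred Var K, r ∈ PIa → _ := fun r hr => h r (Or.inl (Or.inl hr))
  have hk : ∀ r : FORule MetaPred Var K, r ∈ PIgCheck → _ := fun r hr => h r (Or.inl (Or.inr hr))
  simp only [PIa, PIgCheck, List.mem_cons, List.not_mem_nil, or_false, forall_eq_or_imp, forall_eq,
    exists_eq_left, groundLit_lit, List.map_cons, List.map_nil, subst_lessVar, false_imp_iff,
    implies_true, true_imp_iff, false_and, exists_false] at ha hk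
  obtain ⟨a1, a2, a3, a4, a5, a6, a7, a8, a9, a10, a11⟩ := ha
  obtain ⟨k1, k2, k3, k4, k5, k6, k7, k8, k9, k10, k11⟩ := hk
  have hu : ∀ {p : MetaPred} {cs : List K}, holds X p cs → ∀ c ∈ cs,
      c ∈ herbrandUniverse (program litC ruleId P) :=
    fun h c hc => (hB h).2 c hc
  refine ⟨?_, ?_, ?_⟩
  · intro p cs hder
    cases hder with
    | rule h =>
      obtain ⟨q, hq, rfl⟩ := h
      exact hfact _ _ (Or.inl (Or.inl ⟨q, hq, Or.inl rfl⟩))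
    | head h =>
      obtain ⟨q, hq, l, hl, rfl, rfl⟩ := h
      exact hfact _ _ (Or.inl (Or.inl ⟨q, hq, Or.inr (Or.inl ⟨l, hl, rfl⟩)⟩))
    | pbl h =>
      obtain ⟨q, hq, l, hl, rfl, rfl⟩ := h
      exact hfact _ _ (Or.inl (Or.inl ⟨q, hq, Or.inr (Or.inr (Or.inl ⟨l, hl, rfl⟩))⟩))
    | nbl h =>
      obtain ⟨q, hq, l, hl, rfl, rfl⟩ := h
      exact hfact _ _ (Or.inl (Or.inl ⟨q, hq, Or.inr (Or.inr (Or.inr ⟨l, hl, rfl⟩))⟩))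
    | compl h =>
      obtain ⟨a, h1, h2, rfl, rfl⟩ := h
      exact hfact _ _ (Or.inl (Or.inr ⟨a, h1, h2, rfl⟩))
    | pr h =>
      obtain ⟨q, q', h, rfl, rfl⟩ := h
      exact hfact _ _ (Or.inr ⟨q, q', h, rfl⟩)
    | @in_AS x r h1 h2 h3 =>
      exact a1 (assign x d d r d d d d) (assign_mem (hu h1 _ (by simp)) hd hd (hu h2 _ (by simp))
        hd hd hd hd) ⟨h1, h2⟩ h3
    | @pos_body_exists x r h1 =>
      exact a2 (assign x d d r d d d d) (assign_mem (hu h1 _ (by simp)) hd hd (hu h1 _ (by simp))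
        hd hd hd hd) h1
    | @pos_body_true_empty r h1 h2 =>
      exact a3 (assign d d d r d d d d) (assign_mem hd hd hd (hu h1 _ (by simp))
        hd hd hd hd) h1 h2
    | @pbl_inbetween x y z r h1 h2 h3 h4 h5 =>
      exact a4 (assign x y z r d d d d) (assign_mem (hu h1 _ (by simp)) (hu h2 _ (by simp))
        (hu h3 _ (by simp)) (hu h1 _ (by simp)) hd hd hd hd) ⟨h4, h5⟩ ⟨h1, h2, h3⟩
    | @pbl_notlast x y r h1 h2 h3 =>
      exact a5 (assign x y d r d d d d) (assign_mem (hu h1 _ (by simp)) (hu h2 _ (by simp))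
        hd (hu h1 _ (by simp)) hd hd hd hd) h3 ⟨h1, h2⟩
    | @pbl_notfirst x y r h1 h2 h3 =>
      exact a6 (assign x y d r d d d d) (assign_mem (hu h1 _ (by simp)) (hu h2 _ (by simp))
        hd (hu h1 _ (by simp)) hd hd hd hd) h3 ⟨h1, h2⟩
    | @upto_first x r h1 h2 h3 =>
      exact a7 (assign x d d r d d d d) (assign_mem (hu h1 _ (by simp)) hd hd (hu h1 _ (by simp))
        hd hd hd hd) ⟨h1, h2⟩ h3
    | @upto_next x y r h1 h2 h3 h4 h5 =>
      exact a8 (assign x y d r d d d d) (assign_mem (hu h2 _ (by simp)) (hu h1 _ (by simp)) hd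
        (hu h1 _ (by simp)) hd hd hd hd) h5 ⟨h1, h2, h3⟩ h4
    | @pos_body_true_last x r h1 h2 =>
      exact a9 (assign x d d r d d d d) (assign_mem (hu h1 _ (by simp)) hd hd (hu h1 _ (by simp))
        hd hd hd hd) h1 h2
    | @neg_body_false x y h1 h2 =>
      exact a10 (assign x y d d d d d d) (assign_mem (hu h1 _ (by simp)) (hu h1 _ (by simp)) hd
        hd hd hd hd hd) ⟨h1, h2⟩
    | @g r h1 h2 h3 =>
      exact k1 (assign d d d r d d d d) (assign_mem hd hd hd (hu h1 _ (by simp))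
        hd hd hd hd) ⟨h1, h2⟩ h3
    | @z x r h1 h2 h3 h4 =>
      exact k2 (assign x d d r d d d d) (assign_mem (hu h3 _ (by simp)) hd hd (hu h1 _ (by simp))
        hd hd hd hd) ⟨h1, h2, h3⟩ h4
    | @stage s h1 =>
      exact k3 (assign d d d d d s d d) (assign_mem hd hd hd hd hd (hu h1 _ (by simp)) hd hd) h1
    | @nosource0 r1 r h1 =>
      exact k4 (assign d d d r r1 d d d) (assign_mem hd hd hd (hu h1 _ (by simp))
        (hu h1 _ (by simp)) hd hd hd) h1
    | @remove_source r s h1 h2 h3 h4 =>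
      exact k5 (assign d d d r d s d d) (assign_mem hd hd hd (hu h1 _ (by simp)) hd
        (hu h2 _ (by simp)) hd hd) ⟨h1, h2⟩ ⟨h3, h4⟩
    | @nosource r1 r s h1 h2 h3 =>
      exact k6 (assign d d d r r1 s d d) (assign_mem hd hd hd (hu h1 _ (by simp))
        (hu h1 _ (by simp)) (hu h2 _ (by simp)) hd hd) ⟨h1, h2⟩ h3
    | @remove_next r s s1 h1 h2 h3 h4 h5 h6 h7 =>
      exact k7 (assign d d d r d s s1 d) (assign_mem hd hd hd (hu h1 _ (by simp)) hd
        (hu h2 _ (by simp)) (hu h3 _ (by simp)) hd) h7 ⟨h1, h2, h3⟩ ⟨h4, h5, h6⟩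
    | @remove_zombie x r s s1 h1 h2 h3 h4 h5 h6 h7 h8 =>
      exact k8 (assign x d d r d s s1 d) (assign_mem (hu h5 _ (by simp)) hd hd (hu h1 _ (by simp))
        hd (hu h2 _ (by simp)) (hu h3 _ (by simp)) hd) h8 ⟨h1, h2, h3, h4, h5, h6⟩ h7
    | @s x r st h1 h2 h3 =>
      exact k9 (assign x d d r d d d st) (assign_mem (hu h3 _ (by simp)) hd hd (hu h2 _ (by simp))
        hd hd hd (hu h1 _ (by simp))) ⟨h1, h2, h3⟩
    | @removed r s h1 =>
      exact k10 (assign d d d r d s d d) (assign_mem hd hd hd (hu h1 _ (by simp))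
        hd (hu h1 _ (by simp)) hd hd) h1
  · intro x y h1 h2 h3
    exact a11 (assign x y d d d d d d) (assign_mem (hu h2 _ (by simp)) (hu h3 _ (by simp)) hd
      hd hd hd hd hd) ⟨h1, h2, h3⟩
  · intro r h1
    by_contra h2
    exact k11 (assign d d d r d d d d) (assign_mem hd hd hd (hu h1 _ (by simp))
      hd hd hd hd) h1 h2

end Translation

/-! ### Answer sets of the meta-program as least sets relative to themselves. -/

section AnswerSets

variable {α K : Type*} [Nonempty K] [LinearOrder K]
variable {litC : Lit α → K} {ruleId : Rule α → K} {P : PrioritizedProgram α}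

/-- The number of arguments of the predicates of the meta-program. -/
def arity : MetaPred → ℕ
  | .rule | .in_AS | .pos_body_exists | .pos_body_true | .neg_body_false | .g | .z | .stage
  | .nosource0 | .removed => 1
  | .head | .pbl | .nbl | .compl | .pr | .pos_body_true_upto | .pbl_notlast | .pbl_notfirst
  | .nosource | .remove | .s => 2
  | .pbl_inbetween => 3

/-- Every predicate occurs in a head or positive body of a meta-rule with its intended arity, so the
literal base contains it even when `P` contributes no fact for it. -/
theorem exists_mem_foOccurring (p : MetaPred) :
    ∃ k ∈ foOccurring (program litC ruleId P),
      k.atom.pred = p ∧ k.atom.args.length = arity p := by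
  have ha : ∀ (i : ℕ) (hi : i < (PIa : List (FORule MetaPred Var K)).length) (q : MetaPred)
      (xs : List Var), lit q xs ∈ PIa[i].head ++ PIa[i].pos → xs.length = arity q →
      ∃ k ∈ foOccurring (program litC ruleId P),
        k.atom.pred = q ∧ k.atom.args.length = arity q := by
    intro i hi q xs h hl
    refine ⟨lit q xs, ⟨_, Or.inl (Or.inl (List.getElem_mem hi)), ?_⟩, rfl, by simp [lit, Lit.atom, hl]⟩
    rcases List.mem_append.1 h with h | h
    · exact Or.inl h
    · exact Or.inr (Or.inl h)
  have hk : ∀ (i : ℕ) (hi : i < (PIgCheck : List (FORule MetaPred Var K)).length) (q : MetaPred)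
      (xs : List Var), lit q xs ∈ PIgCheck[i].head ++ PIgCheck[i].pos → xs.length = arity q →
      ∃ k ∈ foOccurring (program litC ruleId P),
        k.atom.pred = q ∧ k.atom.args.length = arity q := by
    intro i hi q xs h hl
    refine ⟨lit q xs, ⟨_, Or.inl (Or.inr (List.getElem_mem hi)), ?_⟩, rfl, by simp [lit, Lit.atom, hl]⟩
    rcases List.mem_append.1 h with h | h
    · exact Or.inl h
    · exact Or.inr (Or.inl h)
  cases p with
  | rule => exact ha 2 (by simp [PIa]) _ [.R] (by simp [PIa]) rfl
  | head => exact ha 0 (by simp [PIa]) _ [.X, .R] (by simp [PIa]) rfl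
  | pbl => exact ha 1 (by simp [PIa]) _ [.X, .R] (by simp [PIa]) rfl
  | nbl => exact ha 9 (by simp [PIa]) _ [.X, .Y] (by simp [PIa]) rfl
  | compl => exact ha 10 (by simp [PIa]) _ [.X, .Y] (by simp [PIa]) rfl
  | pr => exact hk 3 (by simp [PIgCheck]) _ [.R1, .R] (by simp [PIgCheck]) rfl
  | in_AS => exact ha 0 (by simp [PIa]) _ [.X] (by simp [PIa]) rfl
  | pos_body_exists => exact ha 1 (by simp [PIa]) _ [.R] (by simp [PIa]) rfl
  | pos_body_true => exact ha 2 (by simp [PIa]) _ [.R] (by simp [PIa]) rfl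
  | pos_body_true_upto => exact ha 6 (by simp [PIa]) _ [.R, .X] (by simp [PIa]) rfl
  | pbl_inbetween => exact ha 3 (by simp [PIa]) _ [.X, .Y, .R] (by simp [PIa]) rfl
  | pbl_notlast => exact ha 4 (by simp [PIa]) _ [.X, .R] (by simp [PIa]) rfl
  | pbl_notfirst => exact ha 5 (by simp [PIa]) _ [.X, .R] (by simp [PIa]) rfl
  | neg_body_false => exact ha 9 (by simp [PIa]) _ [.Y] (by simp [PIa]) rfl
  | g => exact hk 0 (by simp [PIgCheck]) _ [.R] (by simp [PIgCheck]) rfl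
  | z => exact hk 1 (by simp [PIgCheck]) _ [.R] (by simp [PIgCheck]) rfl
  | stage => exact hk 2 (by simp [PIgCheck]) _ [.S] (by simp [PIgCheck]) rfl
  | nosource0 => exact hk 3 (by simp [PIgCheck]) _ [.R] (by simp [PIgCheck]) rfl
  | nosource => exact hk 5 (by simp [PIgCheck]) _ [.R, .S] (by simp [PIgCheck]) rfl
  | remove => exact hk 4 (by simp [PIgCheck]) _ [.R, .S] (by simp [PIgCheck]) rfl
  | s => exact hk 8 (by simp [PIgCheck]) _ [.X, .St] (by simp [PIgCheck]) rfl
  | removed => exact hk 9 (by simp [PIgCheck]) _ [.R] (by simp [PIgCheck]) rfl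

/-- Gives, by leastness, that a least closed set lies in the literal base. -/
theorem derClosed_base (N : MetaPred → List K → Prop) :
    DerClosed litC ruleId P N fun p cs =>
      cs.length = arity p ∧ ∀ c ∈ cs, c ∈ herbrandUniverse (program litC ruleId P) := by
  have hf : ∀ {p : MetaPred} {cs : List K}, fact p cs ∈ facts litC ruleId P → ∀ c ∈ cs,
      c ∈ herbrandUniverse (program litC ruleId P) :=
    fun h c hc => mem_herbrandUniverse_of_fact (Or.inr h) hc
  intro p cs h
  refine ⟨by cases h <;> rfl, ?_⟩
  cases h with
  | rule h =>
    obtain ⟨q, hq, rfl⟩ := h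
    exact hf (p := .rule) (Or.inl (Or.inl ⟨q, hq, Or.inl rfl⟩))
  | head h =>
    obtain ⟨q, hq, l, hl, rfl, rfl⟩ := h
    exact hf (p := .head) (Or.inl (Or.inl ⟨q, hq, Or.inr (Or.inl ⟨l, hl, rfl⟩)⟩))
  | pbl h =>
    obtain ⟨q, hq, l, hl, rfl, rfl⟩ := h
    exact hf (p := .pbl) (Or.inl (Or.inl ⟨q, hq, Or.inr (Or.inr (Or.inl ⟨l, hl, rfl⟩))⟩))
  | nbl h =>
    obtain ⟨q, hq, l, hl, rfl, rfl⟩ := h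
    exact hf (p := .nbl) (Or.inl (Or.inl ⟨q, hq, Or.inr (Or.inr (Or.inr ⟨l, hl, rfl⟩))⟩))
  | compl h =>
    obtain ⟨a, h1, h2, rfl, rfl⟩ := h
    exact hf (p := .compl) (Or.inl (Or.inr ⟨a, h1, h2, rfl⟩))
  | pr h =>
    obtain ⟨q, q', h, rfl, rfl⟩ := h
    exact hf (p := .pr) (Or.inr ⟨q, q', h, rfl⟩)
  | _ => simp_all

/-- All heads are positive, so a minimal model contains no strongly negated literal and consistency
is automatic. The constraints have no head and only filter the least models. -/
theorem mem_foAS_iff {I : Set (Lit (Atom MetaPred K))} :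
    I ∈ foAS (program litC ruleId P) ↔
      I ⊆ posLits (holds I) ∧ IsLeastDer litC ruleId P (holds I) (holds I) ∧
        Constraints (holds I) (holds I) := by
  constructor
  · rintro ⟨⟨hB, hcons, hclosed⟩, hmin⟩
    obtain ⟨hder, hcon⟩ := derClosed_of_closedUnder hB hclosed
    -- Intersecting `I` with a closed `U`, and discarding its negative literals, yields a smaller
    -- model of the same reduct; minimality makes it all of `I`. Smaller sets still satisfy the
    -- constraints, whose negated atoms are evaluated in the fixed `I`.
    have key : ∀ U, DerClosed litC ruleId P (holds I) U →
        I ⊆ posLits (fun p cs => holds I p cs ∧ U p cs) := by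
      intro U hU
      have hsub : posLits (fun p cs => holds I p cs ∧ U p cs) ⊆ I := by
        rintro _ ⟨p, cs, rfl, h, -⟩
        exact h
      refine hmin ⟨hsub.trans hB, ?_, ?_⟩ hsub
      · exact Set.subset_eq_empty
          (Set.inter_subset_inter hsub (Set.image_mono hsub)) hcons
      · apply closedUnder_of_derClosed
        · rw [holds_posLits]
          exact fun p cs h => ⟨hder _ _ (h.mono fun _ _ h => h.1), hU _ _ (h.mono fun _ _ h => h.2)⟩
        · rw [holds_posLits]
          exact ⟨fun x y h1 h2 h3 => hcon.compl x y h1.1 h2.1 h3.1,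
            fun k h => hcon.removed k h.1⟩
    refine ⟨?_, ⟨hder, ?_⟩, hcon⟩
    · intro l hl
      obtain ⟨p, cs, rfl, h, -⟩ := key _ hder hl
      exact ⟨p, cs, rfl, h⟩
    · intro U hU p cs h
      obtain ⟨p', cs', he, h⟩ := key _ hU h
      cases he
      exact h.2
  · rintro ⟨hpos, hleast, hcon⟩
    refine ⟨⟨?_, ?_, closedUnder_of_derClosed hleast.closed hcon⟩, ?_⟩
    · intro l hl
      obtain ⟨p, cs, rfl, h⟩ := hpos hl
      obtain ⟨h1, h2⟩ := hleast.least _ (derClosed_base _) _ _ h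
      obtain ⟨k, hk, hkp, hka⟩ := exists_mem_foOccurring (litC := litC) (ruleId := ruleId)
        (P := P) p
      exact ⟨⟨k, hk, hkp, hka.trans h1.symm⟩, h2⟩
    · refine Set.eq_empty_of_forall_notMem ?_
      rintro l ⟨hl, k, hk, rfl⟩
      obtain ⟨p, cs, rfl, -⟩ := hpos hk
      obtain ⟨p', cs', he, -⟩ := hpos hl
      cases he
    · rintro Y ⟨hYB, -, hY⟩ -
      intro l hl
      obtain ⟨p, cs, rfl, h⟩ := hpos hl
      exact hleast.least _ (derClosed_of_closedUnder hYB hY).1 _ _ h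

end AnswerSets

/-! ### Generating rules, total orders and the dual reduct. -/

section Preference

variable {α : Type*}

/-- `r` belongs to the reduct and its body is true in `A`. -/
def Generating (A : Set (Lit α)) (r : Rule α) : Prop := r.Bpos ⊆ A ∧ ¬ r.DefeatedBy A

/-- The positive body of `r` is true in `A`, but its head is not. -/
def Zombie (A : Set (Lit α)) (r : Rule α) : Prop := r.Bpos ⊆ A ∧ ¬ r.H ⊆ A

/-- Every zombie is defeated by the head of a generating rule of higher priority. -/
def ZombiesDefeated (P : PrioritizedProgram α) (A : Set (Lit α)) : Prop :=
  ∀ r ∈ P.rules, Zombie A r → ∃ q, P.lt q r ∧ Generating A q ∧ (q.H ∩ r.Bneg).Nonempty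

theorem closedUnder_reduct_iff {P : Set (Rule α)} {X A : Set (Lit α)} :
    ClosedUnder X (reduct P A) ↔
      ∀ r ∈ P, ¬ r.DefeatedBy A → r.Bpos ⊆ X → (r.H ∩ X).Nonempty :=
  ⟨fun h r hr hd hX => h r.dropNeg ⟨r, hr, hd, rfl⟩ hX,
    by rintro h _ ⟨r, hr, hd, rfl⟩ hX; exact h r hr hd hX⟩

theorem Consistent.mono {X Y : Set (Lit α)} (h : X ⊆ Y) (hY : Consistent Y) : Consistent X :=
  Set.subset_eq_empty (Set.inter_subset_inter h (Set.image_mono h)) hY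

namespace PrioritizedProgram

theorem inter_H_nonempty_iff (P : PrioritizedProgram α) {r : Rule α} (hr : r ∈ P.rules)
    {X : Set (Lit α)} : (r.H ∩ X).Nonempty ↔ r.H ⊆ X := by
  obtain ⟨c, hc⟩ := P.normal r hr
  rw [hc, Set.singleton_inter_nonempty, Set.singleton_subset_iff]

theorem closedUnder_iff (P : PrioritizedProgram α) {X A : Set (Lit α)} :
    ClosedUnder X (reduct P.rules A) ↔
      ∀ r ∈ P.rules, ¬ r.DefeatedBy A → r.Bpos ⊆ X → r.H ⊆ X := by
  rw [closedUnder_reduct_iff]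
  exact forall₂_congr fun r hr => by rw [P.inter_H_nonempty_iff hr]

/-- An answer set is the least set closed under its reduct. -/
theorem subset_of_closed (P : PrioritizedProgram α) {A X : Set (Lit α)} (hA : A ∈ AS P.rules)
    (hX : ∀ r ∈ P.rules, ¬ r.DefeatedBy A → r.Bpos ⊆ A → r.Bpos ⊆ X → r.H ⊆ A → r.H ⊆ X) :
    A ⊆ X := by
  obtain ⟨⟨hB, hcons, hcl⟩, hmin⟩ := hA
  rw [P.closedUnder_iff] at hcl
  -- The competitor is `A ∩ X`; intersecting with `A` is what makes the extra premises about `A` in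
  -- `hX` available.
  refine (hmin ⟨Set.inter_subset_left.trans hB, Consistent.mono Set.inter_subset_left hcons, ?_⟩
    Set.inter_subset_left).trans (Set.inter_subset_right (s := A) (t := X))
  rw [P.closedUnder_iff]
  intro r hr hd hb
  have h1 := hb.trans Set.inter_subset_left
  have h2 := hcl r hr hd h1
  exact Set.subset_inter h2 (hX r hr hd h1 (hb.trans Set.inter_subset_right) h2)

theorem H_subset_of_generating (P : PrioritizedProgram α) {A : Set (Lit α)}
    (hA : A ∈ AS P.rules) {r : Rule α} (hr : r ∈ P.rules) (hg : Generating A r) : r.H ⊆ A :=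
  P.closedUnder_iff.1 hA.1.2.2 r hr hg.2 hg.1

theorem exists_generating (P : PrioritizedProgram α) {A : Set (Lit α)} (hA : A ∈ AS P.rules)
    {l : Lit α} (hl : l ∈ A) : ∃ r ∈ P.rules, Generating A r ∧ l ∈ r.H :=
  P.subset_of_closed hA (X := {l | ∃ r ∈ P.rules, Generating A r ∧ l ∈ r.H})
    (fun r hr hd hb _ _ _ hl => ⟨r, hr, ⟨hb, hd⟩, hl⟩) hl

/-- The order is total on the rules. -/
def IsTotal (P : PrioritizedProgram α) : Prop :=
  ∀ r ∈ P.rules, ∀ r' ∈ P.rules, r ≠ r' → P.lt r r' ∨ P.lt r' r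

theorem asymm (P : PrioritizedProgram α) {r r' : Rule α} (h : P.lt r r') : ¬ P.lt r' r :=
  fun h' => P.irrefl _ (P.trans h h')

theorem ext' {P Q : PrioritizedProgram α} (h : P.rules = Q.rules)
    (hlt : ∀ r r', P.lt r r' ↔ Q.lt r r') : P = Q := by
  obtain ⟨R, _, _, lt, _, _, _⟩ := P
  obtain ⟨R', _, _, lt', _, _, _⟩ := Q
  obtain rfl : R = R' := h
  obtain rfl : lt = lt' := funext₂ fun r r' => propext (hlt r r')
  rfl

theorem IsTotal.fullyPrioritized {P : PrioritizedProgram α} (h : P.IsTotal) :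
    P.FullyPrioritized := by
  refine Set.eq_singleton_iff_unique_mem.2 ⟨⟨rfl, h, fun _ _ => id⟩, ?_⟩
  rintro Q ⟨hQ, -, hlt⟩
  refine ext' hQ fun r r' => ⟨fun hq => ?_, hlt r r'⟩
  obtain ⟨h1, h2⟩ := Q.lt_mem hq
  rw [hQ] at h1 h2
  have hne : r ≠ r' := by
    rintro rfl
    exact Q.irrefl _ hq
  exact (h r h1 r' h2 hne).resolve_right fun h' => Q.asymm hq (hlt _ _ h')

/-- If `P` is fully prioritized it is the only member of `P.FP`, so the two cases of the definition
merge. -/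
theorem mem_BPAS_iff {P : PrioritizedProgram α} {A : Set (Lit α)} :
    A ∈ BPAS P ↔ A ∈ AS P.rules ∧ ∃ Q ∈ P.FP, IsBPrefFull Q A := by
  constructor
  · rintro ⟨hA, ⟨hP, hb⟩ | ⟨-, h⟩⟩
    · exact ⟨hA, P, by rw [hP]; rfl, hb⟩
    · exact ⟨hA, h⟩
  · rintro ⟨hA, Q, hQ, hb⟩
    by_cases hP : P.FullyPrioritized
    · rw [hP] at hQ
      obtain rfl := hQ
      exact ⟨hA, Or.inl ⟨hP, hb⟩⟩
    · exact ⟨hA, Or.inr ⟨hP, Q, hQ, hb⟩⟩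

/-- The number of rules of higher priority. -/
noncomputable def position (P : PrioritizedProgram α) (r : Rule α) : ℕ := {q | P.lt q r}.ncard

theorem finite_setOf_lt (P : PrioritizedProgram α) (r : Rule α) : {q | P.lt q r}.Finite :=
  P.finite.subset fun _ h => (P.lt_mem h).1

theorem position_lt (P : PrioritizedProgram α) {r r' : Rule α} (h : P.lt r r') :
    P.position r < P.position r' :=
  Set.ncard_lt_ncard ⟨fun _ hq => P.trans hq h, fun hs => P.irrefl r (hs h)⟩
    (P.finite_setOf_lt r')

theorem position_lt_ncard (P : PrioritizedProgram α) {r : Rule α} (h : r ∈ P.rules) :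
    P.position r < P.rules.ncard :=
  Set.ncard_lt_ncard ⟨fun _ hq => (P.lt_mem hq).1, fun hs => P.irrefl r (hs h)⟩ P.finite

theorem IsTotal.exists_isEnumeration {P : PrioritizedProgram α} (hP : P.IsTotal) :
    ∃ L, P.IsEnumeration L := by
  classical
  refine ⟨P.finite.toFinset.toList.mergeSort (fun r q => decide (P.position r ≤ P.position q)),
    fun r => by simp [List.mem_mergeSort], ?_⟩
  have h1 := List.pairwise_mergeSort (le := fun r q => decide (P.position r ≤ P.position q))
    (fun a b c => by simpa using le_trans) (fun a b => by simpa using le_total _ _)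
    P.finite.toFinset.toList
  have h2 : (P.finite.toFinset.toList.mergeSort
      (fun r q => decide (P.position r ≤ P.position q))).Nodup :=
    (List.mergeSort_perm _ _).nodup_iff.2 (Finset.nodup_toList _)
  refine (h1.and h2).imp_of_mem fun {a b} ha hb h => ?_
  simp only [List.mem_mergeSort, Finset.mem_toList, Set.Finite.mem_toFinset, decide_eq_true_eq]
    at ha hb h
  refine (hP a ha b hb h.2).resolve_right fun h' => ?_
  exact (P.position_lt h').not_ge h.1

/-- Among the rules with the same image in the dual reduct, one of least position comes first by
totality. The comparison with `r` serves to transport priorities between a program and its dual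
reduct. -/
theorem IsTotal.exists_isFirst {P : PrioritizedProgram α} (hP : P.IsTotal) {X : Set (Lit α)}
    {r : Rule α} (hr : r ∈ P.rules) (hX : r.Bpos ⊆ X) :
    ∃ q, P.IsFirst X r.dropPos q ∧ (q = r ∨ P.lt q r) := by
  obtain ⟨q, ⟨h1, h2, h3⟩, hmin⟩ := Set.exists_min_image
    {q | q ∈ P.rules ∧ q.Bpos ⊆ X ∧ q.dropPos = r.dropPos} P.position
    (P.finite.subset fun _ h => h.1) ⟨r, hr, hX, rfl⟩
  have hfirst : ∀ q' ∈ P.rules, q'.Bpos ⊆ X → q'.dropPos = r.dropPos → q' ≠ q → P.lt q q' := by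
    intro q' k1 k2 k3 hne
    exact (hP q' k1 q h1 hne).resolve_left fun h =>
      (P.position_lt h).not_ge (hmin q' ⟨k1, k2, k3⟩)
  refine ⟨q, ⟨⟨h1, h2, h3⟩, hfirst⟩, ?_⟩
  by_cases h : r = q
  · exact Or.inl h.symm
  · exact Or.inr (hfirst r hr hX rfl h)

theorem IsTotal.dualReduct {P : PrioritizedProgram α} (hP : P.IsTotal) (X : Set (Lit α)) :
    (P.dualReduct X).IsTotal := by
  rintro _ ⟨r, hr, hX, rfl⟩ _ ⟨r', hr', hX', rfl⟩ hne
  obtain ⟨q, hq, -⟩ := hP.exists_isFirst hr hX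
  obtain ⟨q', hq', -⟩ := hP.exists_isFirst hr' hX'
  have hqq : q ≠ q' := by
    rintro rfl
    exact hne (hq.1.2.2.symm.trans hq'.1.2.2)
  rcases hP q hq.1.1 q' hq'.1.1 hqq with h | h
  · exact Or.inl ⟨q, q', hq, hq', h⟩
  · exact Or.inr ⟨q', q, hq', hq, h⟩

/-- Only positive body literals true in `A` are deleted. The new reduct fires at once each rule that
the old one fires while building up `A`, so a set closed under it still contains `A`. -/
theorem mem_AS_dualReduct (P : PrioritizedProgram α) {A : Set (Lit α)} (hA : A ∈ AS P.rules) :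
    A ∈ AS (P.dualReduct A).rules := by
  refine ⟨⟨?_, hA.1.2.1, ?_⟩, ?_⟩
  · intro l hl
    obtain ⟨r, hr, hg, hlr⟩ := P.exists_generating hA hl
    exact ⟨l, ⟨r.dropPos, ⟨r, hr, hg.1, rfl⟩, Or.inl (Or.inl hlr)⟩, rfl⟩
  · rw [closedUnder_iff]
    rintro _ ⟨r, hr, hX, rfl⟩ hd -
    exact P.H_subset_of_generating (r := r) hA hr ⟨hX, hd⟩
  · rintro Y ⟨-, -, hY⟩ -
    rw [closedUnder_iff] at hY
    refine P.subset_of_closed hA fun r hr hd hb _ _ => ?_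
    exact hY r.dropPos ⟨r, hr, hb, rfl⟩ hd (fun l hl => absurd hl (List.not_mem_nil))

end PrioritizedProgram

end Preference

/-! ### The operator and its description by zombies. -/

section Operator

variable {α : Type*}

theorem subset_step (A S : Set (Lit α)) (r : Rule α) : S ⊆ step A S r := by
  unfold step
  split_ifs
  · exact subset_rfl
  · exact Set.subset_union_left

theorem subset_foldl_step (A : Set (Lit α)) (L : List (Rule α)) (S : Set (Lit α)) :
    S ⊆ L.foldl (step A) S := by
  induction L generalizing S with
  | nil => exact subset_rfl
  | cons r L ih => exact (subset_step A S r).trans (ih _)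

theorem mem_foldl_step {A : Set (Lit α)} {L : List (Rule α)} {l : Lit α}
    (h : l ∈ L.foldl (step A) ∅) :
    ∃ r ∈ L, l ∈ r.H ∧ ¬ (r.H ⊆ A ∧ r.DefeatedBy A) := by
  induction L using List.reverseRecOn with
  | nil => exact h.elim
  | append_singleton L r ih =>
    rw [List.foldl_concat] at h
    unfold step at h
    split_ifs at h with hc
    · obtain ⟨q, hq, h⟩ := ih h
      exact ⟨q, List.mem_append_left _ hq, h⟩
    · rcases h with h | h
      · obtain ⟨q, hq, h⟩ := ih h
        exact ⟨q, List.mem_append_left _ hq, h⟩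
      · exact ⟨r, by simp, h, fun hr => hc (Or.inr hr)⟩

/-- A rule whose head is not in `A` must be skipped, and only the first disjunct of the skip
condition can do this: the set built so far defeats it. The defeating literal was contributed by an
earlier rule. -/
theorem exists_defeating_of_foldl_subset {A : Set (Lit α)} {L₁ L₂ : List (Rule α)} {r : Rule α}
    (h : (L₁ ++ r :: L₂).foldl (step A) ∅ ⊆ A) (hr : ¬ r.H ⊆ A) :
    ∃ q ∈ L₁, ∃ l ∈ q.H, l ∈ A ∧ l ∈ r.Bneg ∧ ¬ (q.H ⊆ A ∧ q.DefeatedBy A) := by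
  rw [List.foldl_append, List.foldl_cons] at h
  have h1 : L₁.foldl (step A) ∅ ⊆ A := (subset_step A _ r).trans ((subset_foldl_step A L₂ _).trans h)
  have h2 : r.DefeatedBy (L₁.foldl (step A) ∅) := by
    by_contra hd
    apply hr
    refine Set.Subset.trans ?_ ((subset_foldl_step A L₂ _).trans h)
    unfold step
    rw [if_neg (by tauto)]
    exact Set.subset_union_right
  obtain ⟨l, hl, hlr⟩ := h2
  obtain ⟨q, hq, hlq, hq'⟩ := mem_foldl_step hl
  exact ⟨q, hq, l, hlq, h1 hl, hlr, hq'⟩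

/-- After each prefix, the set built consists of the heads of the rules in it undefeated by `A`. The
induction rests on `hcase`: a rule is skipped iff `A` defeats it. -/
theorem foldl_step_eq {A : Set (Lit α)} {L : List (Rule α)}
    (hA : ∀ r ∈ L, ¬ r.DefeatedBy A → r.H ⊆ A)
    (hL : ∀ L₁ r L₂, L = L₁ ++ r :: L₂ → ¬ r.H ⊆ A →
      ∃ q ∈ L₁, ¬ q.DefeatedBy A ∧ (q.H ∩ r.Bneg).Nonempty) :
    L.foldl (step A) ∅ = {l | ∃ r ∈ L, ¬ r.DefeatedBy A ∧ l ∈ r.H} := by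
  induction L using List.reverseRecOn with
  | nil => simp
  | append_singleton L r ih =>
    rw [List.foldl_concat, ih (fun q hq => hA q (List.mem_append_left _ hq))
      (fun L₁ q L₂ he => hL L₁ q (L₂ ++ [r]) (by simp [he]))]
    set S : Set (Lit α) := {l | ∃ r ∈ L, ¬ r.DefeatedBy A ∧ l ∈ r.H} with hS
    have hSA : S ⊆ A := by
      rintro l ⟨q, hq, hd, hl⟩
      exact hA q (List.mem_append_left _ hq) hd hl
    have hcase : (r.DefeatedBy S ∨ (r.H ⊆ A ∧ r.DefeatedBy A)) ↔ r.DefeatedBy A := by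
      constructor
      · rintro (⟨l, hl, hlr⟩ | h)
        · exact ⟨l, hSA hl, hlr⟩
        · exact h.2
      · intro hd
        by_cases hr : r.H ⊆ A
        · exact Or.inr ⟨hr, hd⟩
        · obtain ⟨q, hq, hqd, l, hlq, hlr⟩ := hL L r [] rfl hr
          exact Or.inl ⟨l, ⟨q, hq, hqd, hlq⟩, hlr⟩
    by_cases hd : r.DefeatedBy A
    · rw [step, if_pos (hcase.2 hd)]
      ext l
      constructor
      · rintro ⟨q, hq, h⟩
        exact ⟨q, List.mem_append_left _ hq, h⟩
      · rintro ⟨q, hq, hqd, h⟩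
        rcases List.mem_append.1 hq with hq | hq
        · exact ⟨q, hq, hqd, h⟩
        · rw [List.mem_singleton.1 hq] at hqd
          exact absurd hd hqd
    · rw [step, if_neg (hd ∘ hcase.1)]
      ext l
      constructor
      · rintro (⟨q, hq, h⟩ | h)
        · exact ⟨q, List.mem_append_left _ hq, h⟩
        · exact ⟨r, by simp, hd, h⟩
      · rintro ⟨q, hq, hqd, h⟩
        rcases List.mem_append.1 hq with hq | hq
        · exact Or.inl ⟨q, hq, hqd, h⟩
        · rw [List.mem_singleton.1 hq] at h
          exact Or.inr h

/-- If the fold were inconsistent, `C L A` would be the base of a program with at least one literal,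
which contains a complementary pair; but `A` is consistent. -/
theorem foldl_step_eq_of_C_eq {A : Set (Lit α)} {L : List (Rule α)} (hA : Consistent A)
    (h : C L A = A) : L.foldl (step A) ∅ = A := by
  unfold C at h
  split_ifs at h with hc
  · exact h
  · exfalso
    have hne : (L.foldl (step A) ∅ ∩ Lit.compl '' L.foldl (step A) ∅).Nonempty :=
      Set.nonempty_iff_ne_empty.2 hc
    obtain ⟨l, hl, -⟩ := hne
    obtain ⟨r, hr, hlr, -⟩ := mem_foldl_step hl
    have hocc : l ∈ occurring {r | r ∈ L} := ⟨r, hr, Or.inl (Or.inl hlr)⟩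
    have hmem : ∀ k : Lit α, k.atom = l.atom → k ∈ A := by
      intro k hk
      rw [← h]
      exact ⟨l, hocc, hk.symm⟩
    have : l.compl ∈ A ∩ Lit.compl '' A :=
      ⟨hmem _ (by cases l <;> rfl), l, hmem _ rfl, rfl⟩
    rw [hA] at this
    exact this

namespace PrioritizedProgram

/-- `exists_defeating_of_foldl_subset` and `foldl_step_eq` give the two directions in the dual
reduct. What remains is to move between a rule and the first rule with the same image, whose
priority the image inherits. -/
theorem IsTotal.isBPrefFull_iff {Q : PrioritizedProgram α} (hQ : Q.IsTotal) {A : Set (Lit α)}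
    (hA : A ∈ AS Q.rules) : IsBPrefFull Q A ↔ ZombiesDefeated Q A := by
  constructor
  · rintro ⟨-, -, -, -, -, L, ⟨hmem, hpw⟩, hC⟩ r hr ⟨hb, hh⟩
    have hfold := foldl_step_eq_of_C_eq hA.1.2.1 hC
    obtain ⟨L₁, L₂, hL⟩ := List.append_of_mem ((hmem r.dropPos).2 ⟨r, hr, hb, rfl⟩)
    rw [hL] at hfold hpw hmem
    obtain ⟨g, hg, l, hlg, hlA, hlr, hgd⟩ := exists_defeating_of_foldl_subset hfold.subset hh
    obtain ⟨q, f, hq, hf, hqf⟩ := (List.pairwise_append.1 hpw).2.2 g hg r.dropPos (by simp)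
    obtain ⟨rfl⟩ : q.dropPos = g := hq.1.2.2
    have hqA : q.H ⊆ A := (Q.inter_H_nonempty_iff hq.1.1).1 ⟨l, hlg, hlA⟩
    refine ⟨q, ?_, ⟨hq.1.2.1, fun hd => hgd ⟨hqA, hd⟩⟩, l, hlg, hlr⟩
    -- `q` precedes the first preimage `f` of `r.dropPos`, and `f` is `r` or precedes it.
    by_cases hfr : r = f
    · rwa [hfr]
    · exact Q.trans hqf (hf.2 r hr hb rfl hfr)
  · intro h
    have hAd := Q.mem_AS_dualReduct hA
    obtain ⟨L, hL⟩ := (hQ.dualReduct A).exists_isEnumeration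
    refine ⟨hQ.fullyPrioritized, hA, (hQ.dualReduct A).fullyPrioritized, ?_, hAd, L, hL, ?_⟩
    · rintro _ ⟨r, -, -, rfl⟩
      exact Set.eq_empty_of_forall_notMem fun l hl => List.not_mem_nil hl
    obtain ⟨hmem, hpw⟩ := hL
    have hfold : L.foldl (step A) ∅ = A := by
      rw [foldl_step_eq]
      · ext l
        constructor
        · rintro ⟨_, hr, hd, hl⟩
          obtain ⟨r, hr', hb, rfl⟩ := (hmem _).1 hr
          exact Q.H_subset_of_generating (r := r) hA hr' ⟨hb, hd⟩ hl
        · intro hl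
          obtain ⟨r, hr, hg, hlr⟩ := Q.exists_generating hA hl
          exact ⟨r.dropPos, (hmem _).2 ⟨r, hr, hg.1, rfl⟩, hg.2, hlr⟩
      · intro _ hr hd
        obtain ⟨r, hr', hb, rfl⟩ := (hmem _).1 hr
        exact Q.H_subset_of_generating (r := r) hA hr' ⟨hb, hd⟩
      · intro L₁ r' L₂ he hh
        obtain ⟨r₀, hr₀, hb₀, rfl⟩ := (hmem r').1 (by simp [he])
        obtain ⟨f, hf, -⟩ := hQ.exists_isFirst hr₀ hb₀
        have hfH : ¬ f.H ⊆ A := by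
          have : f.dropPos.H = r₀.dropPos.H := by rw [hf.1.2.2]
          rw [← this] at hh
          exact hh
        -- The hypothesis is applied to the first preimage `f`, not to `r₀`: only a rule preceding
        -- `f` is sure to have its image before that of `r₀`.
        obtain ⟨q, hqf, hq, hqn⟩ := h f hf.1.1 ⟨hf.1.2.1, hfH⟩
        obtain ⟨q₀, hq₀, hqq⟩ := hQ.exists_isFirst (Q.lt_mem hqf).1 hq.1
        have hlt : (Q.dualReduct A).lt q.dropPos r₀.dropPos := by
          refine ⟨q₀, f, hq₀, hf, ?_⟩
          rcases hqq with rfl | hqq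
          · exact hqf
          · exact Q.trans hqq hqf
        refine ⟨q.dropPos, ?_, hq.2, ?_⟩
        · have hqL := (hmem q.dropPos).2 ((Q.dualReduct A).lt_mem hlt).1
          rw [he] at hqL hpw
          rcases List.mem_append.1 hqL with h1 | h1
          · exact h1
          · exfalso
            rcases List.mem_cons.1 h1 with h1 | h1
            · rw [h1] at hlt
              exact (Q.dualReduct A).irrefl _ hlt
            · exact (Q.dualReduct A).asymm hlt
                (List.rel_of_pairwise_cons (List.pairwise_append.1 hpw).2.1 h1)
        · have : f.dropPos.Bneg = r₀.dropPos.Bneg := by rw [hf.1.2.2]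
          rw [← this]
          exact hqn
    unfold C
    rw [hfold, if_pos hA.1.2.1]

theorem mem_BPAS_iff_exists_zombiesDefeated {P : PrioritizedProgram α} {A : Set (Lit α)} :
    A ∈ BPAS P ↔ A ∈ AS P.rules ∧ ∃ Q ∈ P.FP, ZombiesDefeated Q A := by
  rw [mem_BPAS_iff]
  refine and_congr_right fun hA => exists_congr fun Q => and_congr_right fun hQ => ?_
  exact IsTotal.isBPrefFull_iff hQ.2.1 (by rwa [hQ.1])

end PrioritizedProgram

end Operator

/-! ### Meaning of each meta-predicate in a least closed set. -/

section Interpretation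

variable {α K : Type*} [LinearOrder K]
variable {litC : Lit α → K} {ruleId : Rule α → K} {P : PrioritizedProgram α}
variable {N T : MetaPred → List K → Prop}

variable (litC) in
/-- The literals that are true according to a set of atoms of the meta-program. -/
def trueLits (T : MetaPred → List K → Prop) : Set (Lit α) := {l | T .in_AS [litC l]}

/-- The two sets of atoms agree on the auxiliary predicates for positive bodies. -/
structure BodyAgree (N T : MetaPred → List K → Prop) : Prop where
  pos_body_exists : ∀ k, N .pos_body_exists [k] ↔ T .pos_body_exists [k]
  pbl_inbetween : ∀ x y k, N .pbl_inbetween [x, y, k] ↔ T .pbl_inbetween [x, y, k]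
  pbl_notlast : ∀ x k, N .pbl_notlast [x, k] ↔ T .pbl_notlast [x, k]
  pbl_notfirst : ∀ x k, N .pbl_notfirst [x, k] ↔ T .pbl_notfirst [x, k]

namespace IsLeastDer

theorem rule_iff (h : IsLeastDer litC ruleId P N T) {k : K} :
    T .rule [k] ↔ ∃ q ∈ P.rules, k = ruleId q := by
  rw [h.iff]
  exact ⟨fun h => by cases h; assumption, .rule⟩

theorem head_iff (h : IsLeastDer litC ruleId P N T) {x k : K} :
    T .head [x, k] ↔ ∃ q ∈ P.rules, ∃ l ∈ q.H, x = litC l ∧ k = ruleId q := by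
  rw [h.iff]
  exact ⟨fun h => by cases h; assumption, .head⟩

theorem pbl_iff (h : IsLeastDer litC ruleId P N T) {x k : K} :
    T .pbl [x, k] ↔ ∃ q ∈ P.rules, ∃ l ∈ q.Bpos, x = litC l ∧ k = ruleId q := by
  rw [h.iff]
  exact ⟨fun h => by cases h; assumption, .pbl⟩

theorem nbl_iff (h : IsLeastDer litC ruleId P N T) {x k : K} :
    T .nbl [x, k] ↔ ∃ q ∈ P.rules, ∃ l ∈ q.Bneg, x = litC l ∧ k = ruleId q := by
  rw [h.iff]
  exact ⟨fun h => by cases h; assumption, .nbl⟩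

theorem compl_iff (h : IsLeastDer litC ruleId P N T) {x y : K} :
    T .compl [x, y] ↔ ∃ a, Lit.pos a ∈ occurring P.rules ∧ Lit.neg a ∈ occurring P.rules ∧
      x = litC (.pos a) ∧ y = litC (.neg a) := by
  rw [h.iff]
  exact ⟨fun h => by cases h; assumption, .compl⟩

theorem pr_iff (h : IsLeastDer litC ruleId P N T) {k k' : K} :
    T .pr [k, k'] ↔ ∃ q q', Covers P q q' ∧ k = ruleId q ∧ k' = ruleId q' := by
  rw [h.iff]
  exact ⟨fun h => by cases h; assumption, .pr⟩

theorem stage_iff (h : IsLeastDer litC ruleId P N T) {k : K} :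
    T .stage [k] ↔ ∃ q ∈ P.rules, k = ruleId q := by
  rw [h.iff, ← h.rule_iff]
  exact ⟨fun h => by cases h; assumption, .stage⟩

theorem pos_body_exists_iff (h : IsLeastDer litC ruleId P N T) {k : K} :
    T .pos_body_exists [k] ↔ ∃ q ∈ P.rules, k = ruleId q ∧ q.Bpos.Nonempty := by
  rw [h.iff]
  constructor
  · intro hd
    cases hd with
    | pos_body_exists hx =>
      obtain ⟨q, hq, l, hl, -, hk⟩ := h.pbl_iff.1 hx
      exact ⟨q, hq, hk, l, hl⟩
  · rintro ⟨q, hq, hk, l, hl⟩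
    exact .pos_body_exists (h.pbl_iff.2 ⟨q, hq, l, hl, rfl, hk⟩)

theorem pbl_inbetween_iff (h : IsLeastDer litC ruleId P N T) {x y k : K} :
    T .pbl_inbetween [x, y, k] ↔
      T .pbl [x, k] ∧ T .pbl [y, k] ∧ ∃ z, T .pbl [z, k] ∧ x < z ∧ z < y := by
  rw [h.iff]
  constructor
  · intro hd
    cases hd with
    | pbl_inbetween h1 h2 h3 h4 h5 => exact ⟨h1, h2, _, h3, h4, h5⟩
  · rintro ⟨h1, h2, z, h3, h4, h5⟩
    exact .pbl_inbetween h1 h2 h3 h4 h5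

theorem pbl_notlast_iff (h : IsLeastDer litC ruleId P N T) {x k : K} :
    T .pbl_notlast [x, k] ↔ T .pbl [x, k] ∧ ∃ y, T .pbl [y, k] ∧ x < y := by
  rw [h.iff]
  constructor
  · intro hd
    cases hd with
    | pbl_notlast h1 h2 h3 => exact ⟨h1, _, h2, h3⟩
  · rintro ⟨h1, y, h2, h3⟩
    exact .pbl_notlast h1 h2 h3

theorem pbl_notfirst_iff (h : IsLeastDer litC ruleId P N T) {x k : K} :
    T .pbl_notfirst [x, k] ↔ T .pbl [x, k] ∧ ∃ y, T .pbl [y, k] ∧ y < x := by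
  rw [h.iff]
  constructor
  · intro hd
    cases hd with
    | pbl_notfirst h1 h2 h3 => exact ⟨h1, _, h2, h3⟩
  · rintro ⟨h1, y, h2, h3⟩
    exact .pbl_notfirst h1 h2 h3

theorem pbl_ruleId_iff (h : IsLeastDer litC ruleId P N T) (hruleId : Set.InjOn ruleId P.rules)
    {q : Rule α} (hq : q ∈ P.rules) {x : K} :
    T .pbl [x, ruleId q] ↔ ∃ l ∈ q.Bpos, x = litC l := by
  rw [h.pbl_iff]
  constructor
  · rintro ⟨q', hq', l, hl, hx, hk⟩
    obtain rfl := hruleId hq hq' hk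
    exact ⟨l, hl, hx⟩
  · rintro ⟨l, hl, hx⟩
    exact ⟨q, hq, l, hl, hx, rfl⟩

/-- Well-founded induction along the constants naming the body literals: the largest such constant
below `x` has nothing in between, and if there is none, `x` is first. -/
theorem pos_body_true_upto_of_forall (h : IsLeastDer litC ruleId P N T) (hN : BodyAgree N T)
    (hruleId : Set.InjOn ruleId P.rules) {q : Rule α} (hq : q ∈ P.rules)
    (hb : ∀ l ∈ q.Bpos, T .in_AS [litC l]) {l : Lit α} (hl : l ∈ q.Bpos) :
    T .pos_body_true_upto [ruleId q, litC l] := by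
  have hfin : (litC '' q.Bpos).Finite := (List.finite_toSet q.pos).image _
  suffices H : ∀ x ∈ litC '' q.Bpos, T .pos_body_true_upto [ruleId q, x] from H _ ⟨l, hl, rfl⟩
  intro x hx
  refine (hfin.wellFoundedOn (r := (· < ·))).induction hx
    (P := fun x => T .pos_body_true_upto [ruleId q, x]) fun x hx ih => ?_
  have hpbl : ∀ y ∈ litC '' q.Bpos, T .pbl [y, ruleId q] := by
    rintro _ ⟨l, hl, rfl⟩
    exact (h.pbl_ruleId_iff hruleId hq).2 ⟨l, hl, rfl⟩
  have hin : T .in_AS [x] := by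
    obtain ⟨l, hl, rfl⟩ := hx
    exact hb l hl
  by_cases hlow : ∃ y ∈ litC '' q.Bpos, y < x
  · obtain ⟨y, ⟨hy, hyx⟩, hmax⟩ := Set.exists_max_image {y | y ∈ litC '' q.Bpos ∧ y < x} id
      (hfin.subset fun _ h => h.1) hlow
    refine h.closed _ _ (.upto_next (ih y hy hyx) (hpbl x hx) hin ?_ hyx)
    rw [hN.pbl_inbetween, h.pbl_inbetween_iff]
    rintro ⟨-, -, z, hz, hyz, hzx⟩
    obtain ⟨l, hl, rfl⟩ := (h.pbl_ruleId_iff hruleId hq).1 hz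
    exact (hmax _ ⟨⟨l, hl, rfl⟩, hzx⟩).not_gt hyz
  · refine h.closed _ _ (.upto_first (hpbl x hx) hin ?_)
    rw [hN.pbl_notfirst, h.pbl_notfirst_iff]
    rintro ⟨-, y, hy, hyx⟩
    obtain ⟨l, hl, rfl⟩ := (h.pbl_ruleId_iff hruleId hq).1 hy
    exact hlow ⟨_, ⟨l, hl, rfl⟩, hyx⟩

theorem pos_body_true_of_forall (h : IsLeastDer litC ruleId P N T) (hN : BodyAgree N T)
    (hruleId : Set.InjOn ruleId P.rules) {q : Rule α} (hq : q ∈ P.rules)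
    (hb : ∀ l ∈ q.Bpos, T .in_AS [litC l]) : T .pos_body_true [ruleId q] := by
  by_cases hne : q.Bpos.Nonempty
  · obtain ⟨l, hl, hmax⟩ := Set.exists_max_image q.Bpos litC (List.finite_toSet q.pos) hne
    refine h.closed _ _ (.pos_body_true_last
      (h.pos_body_true_upto_of_forall hN hruleId hq hb hl) ?_)
    rw [hN.pbl_notlast, h.pbl_notlast_iff]
    rintro ⟨-, y, hy, hxy⟩
    obtain ⟨l', hl', rfl⟩ := (h.pbl_ruleId_iff hruleId hq).1 hy
    exact (hmax l' hl').not_gt hxy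
  · refine h.closed _ _ (.pos_body_true_empty (h.rule_iff.2 ⟨q, hq, rfl⟩) ?_)
    rw [hN.pos_body_exists, h.pos_body_exists_iff]
    rintro ⟨q', hq', hk, hne'⟩
    obtain rfl := hruleId hq hq' hk
    exact hne hne'

/-- The meaning of the predicates for positive bodies relative to a set of literals. -/
def BodyMeaning (litC : Lit α → K) (ruleId : Rule α → K) (P : PrioritizedProgram α)
    (X : Set (Lit α)) : MetaPred → List K → Prop
  | .in_AS, [x] => ∃ l ∈ X, x = litC l
  | .pos_body_true_upto, [k, x] => ∃ q ∈ P.rules, k = ruleId q ∧ ∀ l ∈ q.Bpos, litC l ≤ x → l ∈ X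
  | .pos_body_true, [k] => ∃ q ∈ P.rules, k = ruleId q ∧ q.Bpos ⊆ X
  | _, _ => True

/-- Here `X` is any set closed under the rules not blocked in `N`. It is used with `X` the true
literals, to read off positive bodies; with a competing model, for minimality; and with the given
answer set, as an upper bound. -/
theorem bodyMeaning (h : IsLeastDer litC ruleId P N T) (hN : BodyAgree N T)
    (hlitC : Function.Injective litC) (hruleId : Set.InjOn ruleId P.rules) {X : Set (Lit α)}
    (hX : ∀ q ∈ P.rules, ¬ N .neg_body_false [ruleId q] → q.Bpos ⊆ X → q.H ⊆ X)
    {p : MetaPred} {cs : List K} (hT : T p cs) : BodyMeaning litC ruleId P X p cs := by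
  refine h.induct _ (fun p cs hd => ?_) hT
  cases hd with
  | in_AS h1 h2 h3 =>
    obtain ⟨q, hq, l, hl, rfl, rfl⟩ := h.head_iff.1 h1.1
    obtain ⟨q', hq', hk, hb⟩ := h2.2
    obtain rfl := hruleId hq hq' hk
    exact ⟨l, hX q hq h3 hb hl, rfl⟩
  | pos_body_true_empty h1 h2 =>
    obtain ⟨q, hq, rfl⟩ := h.rule_iff.1 h1.1
    refine ⟨q, hq, rfl, fun l hl => (h2 ?_).elim⟩
    rw [hN.pos_body_exists, h.pos_body_exists_iff]
    exact ⟨q, hq, rfl, l, hl⟩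
  | upto_first h1 h2 h3 =>
    obtain ⟨q, hq, l, hl, rfl, rfl⟩ := h.pbl_iff.1 h1.1
    obtain ⟨l', hl', he⟩ := h2.2
    obtain rfl := hlitC he
    refine ⟨q, hq, rfl, fun l₂ hl₂ hle => ?_⟩
    rcases hle.lt_or_eq with hlt | he
    · refine (h3 ?_).elim
      rw [hN.pbl_notfirst, h.pbl_notfirst_iff]
      exact ⟨h1.1, _, (h.pbl_ruleId_iff hruleId hq).2 ⟨l₂, hl₂, rfl⟩, hlt⟩
    · rwa [hlitC he]
  | @upto_next x y r h1 h2 h3 h4 h5 =>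
    obtain ⟨q, hq, l, hl, rfl, rfl⟩ := h.pbl_iff.1 h2.1
    obtain ⟨l', hl', he⟩ := h3.2
    obtain rfl := hlitC he
    obtain ⟨q', hq', hk, hb⟩ := h1.2
    obtain rfl := hruleId hq hq' hk
    -- Both rules deriving `pos_body_true_upto` require the literal to be in the body;
    -- `pbl_inbetween` needs this for its endpoint.
    have hy : T .pbl [y, ruleId q] := by
      have := h1.1
      rw [h.iff] at this
      cases this <;> assumption
    refine ⟨q, hq, rfl, fun l₂ hl₂ hle => ?_⟩
    rcases hle.lt_or_eq with hlt | he
    · rcases le_or_gt (litC l₂) y with hle' | hlt'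
      · exact hb l₂ hl₂ hle'
      · refine (h4 ?_).elim
        rw [hN.pbl_inbetween, h.pbl_inbetween_iff]
        exact ⟨hy, h2.1, _, (h.pbl_ruleId_iff hruleId hq).2 ⟨l₂, hl₂, rfl⟩, hlt', hlt⟩
    · rwa [hlitC he]
  | @pos_body_true_last x r h1 h2 =>
    obtain ⟨q, hq, rfl, hb⟩ := h1.2
    have hx : T .pbl [x, ruleId q] := by
      have := h1.1
      rw [h.iff] at this
      cases this <;> assumption
    refine ⟨q, hq, rfl, fun l hl => hb l hl (le_of_not_gt fun hlt => h2 ?_)⟩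
    rw [hN.pbl_notlast, h.pbl_notlast_iff]
    exact ⟨hx, _, (h.pbl_ruleId_iff hruleId hq).2 ⟨l, hl, rfl⟩, hlt⟩
  | _ => trivial

theorem in_AS_of_body (h : IsLeastDer litC ruleId P N T) (hN : BodyAgree N T)
    (hruleId : Set.InjOn ruleId P.rules) {q : Rule α} (hq : q ∈ P.rules)
    (hneg : ¬ N .neg_body_false [ruleId q]) (hb : q.Bpos ⊆ trueLits litC T) :
    q.H ⊆ trueLits litC T := fun l hl =>
  h.closed _ _ (.in_AS (h.head_iff.2 ⟨q, hq, l, hl, rfl, rfl⟩)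
    (h.pos_body_true_of_forall hN hruleId hq hb) hneg)

theorem in_AS_iff (h : IsLeastDer litC ruleId P N T) {x : K} :
    T .in_AS [x] ↔ ∃ l ∈ trueLits litC T, x = litC l := by
  constructor
  · intro hx
    have := hx
    rw [h.iff] at this
    cases this with
    | in_AS h1 h2 h3 =>
      obtain ⟨q, hq, l, hl, rfl, -⟩ := h.head_iff.1 h1
      exact ⟨l, hx, rfl⟩
  · rintro ⟨l, hl, rfl⟩
    exact hl

theorem pos_body_true_iff (h : IsLeastDer litC ruleId P N T) (hN : BodyAgree N T)
    (hlitC : Function.Injective litC) (hruleId : Set.InjOn ruleId P.rules) {k : K} :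
    T .pos_body_true [k] ↔ ∃ q ∈ P.rules, k = ruleId q ∧ q.Bpos ⊆ trueLits litC T := by
  constructor
  · exact h.bodyMeaning hN hlitC hruleId fun q hq hneg hb => h.in_AS_of_body hN hruleId hq hneg hb
  · rintro ⟨q, hq, rfl, hb⟩
    exact h.pos_body_true_of_forall hN hruleId hq hb

theorem neg_body_false_iff (h : IsLeastDer litC ruleId P N T) {k : K} :
    T .neg_body_false [k] ↔ ∃ q ∈ P.rules, k = ruleId q ∧ q.DefeatedBy (trueLits litC T) := by
  rw [h.iff]
  constructor
  · intro hd
    cases hd with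
    | neg_body_false h1 h2 =>
      obtain ⟨q, hq, l, hl, rfl, rfl⟩ := h.nbl_iff.1 h1
      exact ⟨q, hq, rfl, l, h2, hl⟩
  · rintro ⟨q, hq, rfl, l, hl, hlq⟩
    exact .neg_body_false (h.nbl_iff.2 ⟨q, hq, l, hlq, rfl, rfl⟩) hl

theorem z_iff (h : IsLeastDer litC ruleId P N T) (hN : BodyAgree N T)
    (hlitC : Function.Injective litC) (hruleId : Set.InjOn ruleId P.rules)
    (hin : ∀ x, N .in_AS [x] ↔ T .in_AS [x]) {k : K} :
    T .z [k] ↔ ∃ q ∈ P.rules, k = ruleId q ∧ Zombie (trueLits litC T) q := by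
  rw [h.iff]
  constructor
  · intro hd
    cases hd with
    | z h1 h2 h3 h4 =>
      obtain ⟨q, hq, l, hl, rfl, rfl⟩ := h.head_iff.1 h3
      obtain ⟨q', hq', hk, hb⟩ := (h.pos_body_true_iff hN hlitC hruleId).1 h2
      obtain rfl := hruleId hq hq' hk
      rw [hin] at h4
      exact ⟨q, hq, rfl, hb, fun hs => h4 (hs hl)⟩
  · rintro ⟨q, hq, rfl, hb, hh⟩
    obtain ⟨l, hl, hlT⟩ := Set.not_subset.1 hh
    refine .z (h.rule_iff.2 ⟨q, hq, rfl⟩) ((h.pos_body_true_iff hN hlitC hruleId).2 ⟨q, hq, rfl, hb⟩)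
      (h.head_iff.2 ⟨q, hq, l, hl, rfl, rfl⟩) ?_
    rwa [hin]

theorem g_iff (h : IsLeastDer litC ruleId P N T) (hN : BodyAgree N T)
    (hlitC : Function.Injective litC) (hruleId : Set.InjOn ruleId P.rules)
    (hneg : ∀ k, N .neg_body_false [k] ↔ T .neg_body_false [k]) {k : K} :
    T .g [k] ↔ ∃ q ∈ P.rules, k = ruleId q ∧ Generating (trueLits litC T) q := by
  rw [h.iff]
  constructor
  · intro hd
    cases hd with
    | g h1 h2 h3 =>
      obtain ⟨q, hq, rfl, hb⟩ := (h.pos_body_true_iff hN hlitC hruleId).1 h2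
      rw [hneg, h.neg_body_false_iff] at h3
      exact ⟨q, hq, rfl, hb, fun hd => h3 ⟨q, hq, rfl, hd⟩⟩
  · rintro ⟨q, hq, rfl, hb, hd⟩
    refine .g (h.rule_iff.2 ⟨q, hq, rfl⟩)
      ((h.pos_body_true_iff hN hlitC hruleId).2 ⟨q, hq, rfl, hb⟩) ?_
    rw [hneg, h.neg_body_false_iff]
    rintro ⟨q', hq', hk, hd'⟩
    obtain rfl := hruleId hq hq' hk
    exact hd hd'

theorem s_iff (h : IsLeastDer litC ruleId P N T) (hN : BodyAgree N T)
    (hlitC : Function.Injective litC) (hruleId : Set.InjOn ruleId P.rules)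
    (hneg : ∀ k, N .neg_body_false [k] ↔ T .neg_body_false [k]) {x st : K} :
    T .s [x, st] ↔ ∃ q ∈ P.rules, T .remove [ruleId q, st] ∧ Generating (trueLits litC T) q ∧
      ∃ l ∈ q.H, x = litC l := by
  rw [h.iff]
  constructor
  · intro hd
    cases hd with
    | s h1 h2 h3 =>
      obtain ⟨q, hq, rfl, hg⟩ := (h.g_iff hN hlitC hruleId hneg).1 h2
      obtain ⟨q', hq', l, hl, rfl, hk⟩ := h.head_iff.1 h3
      obtain rfl := hruleId hq hq' hk
      exact ⟨q, hq, h1, hg, l, hl, rfl⟩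
  · rintro ⟨q, hq, h1, hg, l, hl, rfl⟩
    exact .s h1 ((h.g_iff hN hlitC hruleId hneg).2 ⟨q, hq, rfl, hg⟩)
      (h.head_iff.2 ⟨q, hq, l, hl, rfl, rfl⟩)

theorem nosource0_iff (h : IsLeastDer litC ruleId P N T) {k : K} :
    T .nosource0 [k] ↔ ∃ q q', Covers P q q' ∧ k = ruleId q' := by
  rw [h.iff]
  constructor
  · intro hd
    cases hd with
    | nosource0 h1 =>
      obtain ⟨q, q', hc, -, hk⟩ := h.pr_iff.1 h1
      exact ⟨q, q', hc, hk⟩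
  · rintro ⟨q, q', hc, hk⟩
    exact .nosource0 (h.pr_iff.2 ⟨q, q', hc, rfl, hk⟩)

theorem nosource_iff (h : IsLeastDer litC ruleId P N T) {k s : K} :
    T .nosource [k, s] ↔ (∃ q ∈ P.rules, s = ruleId q) ∧
      ∃ q q', Covers P q q' ∧ k = ruleId q' ∧ ¬ N .remove [ruleId q, s] := by
  rw [h.iff]
  constructor
  · intro hd
    cases hd with
    | nosource h1 h2 h3 =>
      obtain ⟨q, q', hc, rfl, hk⟩ := h.pr_iff.1 h1
      exact ⟨h.stage_iff.1 h2, q, q', hc, hk, h3⟩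
  · rintro ⟨hs, q, q', hc, hk, hr⟩
    exact .nosource (h.pr_iff.2 ⟨q, q', hc, rfl, hk⟩) (h.stage_iff.2 hs) hr

theorem removed_iff (h : IsLeastDer litC ruleId P N T) {k : K} :
    T .removed [k] ↔ ∃ s, T .remove [k, s] := by
  rw [h.iff]
  exact ⟨fun hd => by cases hd with | removed h => exact ⟨_, h⟩, fun ⟨_, h⟩ => .removed h⟩

theorem remove_iff (h : IsLeastDer litC ruleId P N T) {k s : K} :
    T .remove [k, s] ↔ T .rule [k] ∧ T .stage [s] ∧
      ((¬ N .nosource0 [k] ∧ ¬ N .z [k]) ∨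
        ∃ s', T .stage [s'] ∧ s' < s ∧ ¬ N .nosource [k, s'] ∧
          ((¬ N .z [k] ∧ ¬ N .remove [k, s']) ∨
            (T .z [k] ∧ ∃ x, T .nbl [x, k] ∧ T .s [x, s']))) := by
  rw [h.iff (p := .remove)]
  constructor
  · intro hd
    cases hd with
    | remove_source h1 h2 h3 h4 => exact ⟨h1, h2, Or.inl ⟨h3, h4⟩⟩
    | remove_next h1 h2 h3 h4 h5 h6 h7 =>
      exact ⟨h1, h3, Or.inr ⟨_, h2, h7, h4, Or.inl ⟨h5, h6⟩⟩⟩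
    | remove_zombie h1 h2 h3 h4 h5 h6 h7 h8 =>
      exact ⟨h1, h3, Or.inr ⟨_, h2, h8, h7, Or.inr ⟨h4, _, h5, h6⟩⟩⟩
  · rintro ⟨h1, h3, ⟨h4, h5⟩ | ⟨s', h2, h8, h7, ⟨h5, h6⟩ | ⟨h4, x, h5, h6⟩⟩⟩
    · exact .remove_source h1 h3 h4 h5
    · exact .remove_next h1 h2 h3 h7 h5 h6 h8
    · exact .remove_zombie h1 h2 h3 h4 h5 h6 h7 h8

end IsLeastDer

end Interpretation

/-! ### From meta answer sets to B-preferred answer sets. -/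

section Soundness

variable {α K : Type*} [LinearOrder K]
variable {litC : Lit α → K} {ruleId : Rule α → K} {P : PrioritizedProgram α}

/-- A finite strict order is generated by its covering pairs. The induction is on a bound for the
gap in positions, which shrinks whenever a rule is interposed. -/
theorem lt_of_forall_covers {β : Type*} [Preorder β] (P : PrioritizedProgram α) (f : Rule α → β)
    (hf : ∀ r r', Covers P r r' → f r < f r') {r r' : Rule α} (h : P.lt r r') : f r < f r' := by
  suffices H : ∀ (n : ℕ) (r r' : Rule α), P.position r' ≤ P.position r + n → P.lt r r' →
      f r < f r' from H (P.position r') r r' (Nat.le_add_left _ _) h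
  intro n
  induction n with
  | zero => exact fun r r' hn h => absurd (P.position_lt h) (by omega)
  | succ n ih =>
    intro r r' hn h
    by_cases hc : ∃ q, P.lt r q ∧ P.lt q r'
    · obtain ⟨q, h1, h2⟩ := hc
      have := P.position_lt h1
      have := P.position_lt h2
      exact (ih r q (by omega) h1).trans (ih q r' (by omega) h2)
    · exact hf r r' ⟨h, hc⟩

/-- The total order of the rules by the values of `f`, with ties broken by `ruleId`. -/
def PrioritizedProgram.orderBy (P : PrioritizedProgram α) (f ruleId : Rule α → K) :
    PrioritizedProgram α where
  rules := P.rules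
  finite := P.finite
  normal := P.normal
  lt r r' := r ∈ P.rules ∧ r' ∈ P.rules ∧ (f r < f r' ∨ f r = f r' ∧ ruleId r < ruleId r')
  lt_mem h := ⟨h.1, h.2.1⟩
  irrefl r h := by simp at h
  trans := by
    rintro r r' r'' ⟨h1, -, h⟩ ⟨-, h2, h'⟩
    refine ⟨h1, h2, ?_⟩
    rcases h with h | ⟨h, k⟩ <;> rcases h' with h' | ⟨h', k'⟩
    · exact Or.inl (h.trans h')
    · exact Or.inl (h.trans_eq h')
    · exact Or.inl (h.trans_lt h')
    · exact Or.inr ⟨h.trans h', k.trans k'⟩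

theorem PrioritizedProgram.orderBy_mem_FP (P : PrioritizedProgram α) {f ruleId : Rule α → K}
    (hruleId : Set.InjOn ruleId P.rules) (hf : ∀ r r', P.lt r r' → f r < f r') :
    P.orderBy f ruleId ∈ P.FP := by
  refine ⟨rfl, fun r hr r' hr' hne => ?_, fun r r' h =>
    ⟨(P.lt_mem h).1, (P.lt_mem h).2, Or.inl (hf r r' h)⟩⟩
  rcases lt_trichotomy (f r) (f r') with h | h | h
  · exact Or.inl ⟨hr, hr', Or.inl h⟩
  · rcases lt_trichotomy (ruleId r) (ruleId r') with h' | h' | h'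
    · exact Or.inl ⟨hr, hr', Or.inr ⟨h, h'⟩⟩
    · exact absurd (hruleId hr hr' h') hne
    · exact Or.inr ⟨hr', hr, Or.inr ⟨h.symm, h'⟩⟩
  · exact Or.inr ⟨hr', hr, Or.inl h⟩

namespace IsLeastDer

variable {M : MetaPred → List K → Prop}

theorem trueLits_mem_AS (h : IsLeastDer litC ruleId P M M) (hcon : Constraints M M)
    (hlitC : Function.Injective litC) (hruleId : Set.InjOn ruleId P.rules) :
    trueLits litC M ∈ AS P.rules := by
  have hN : BodyAgree M M :=
    ⟨fun _ => Iff.rfl, fun _ _ _ => Iff.rfl, fun _ _ => Iff.rfl, fun _ _ => Iff.rfl⟩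
  have hneg : ∀ q ∈ P.rules, ¬ q.DefeatedBy (trueLits litC M) → ¬ M .neg_body_false [ruleId q] := by
    intro q hq hd hn
    obtain ⟨q', hq', hk, hd'⟩ := h.neg_body_false_iff.1 hn
    obtain rfl := hruleId hq hq' hk
    exact hd hd'
  -- `compl` facts exist only for atoms both of whose literals occur in `P`; true literals occur as
  -- heads, so the constraint covers every possible clash.
  have hocc : ∀ l ∈ trueLits litC M, l ∈ occurring P.rules := by
    intro l hl
    have hl' : M .in_AS [litC l] := hl
    rw [h.iff] at hl'
    cases hl' with
    | in_AS h1 h2 h3 =>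
      obtain ⟨q, hq, l', hl', he, -⟩ := h.head_iff.1 h1
      obtain rfl := hlitC he
      exact ⟨q, hq, Or.inl (Or.inl hl')⟩
  have hcompl : ∀ a, Lit.pos a ∈ trueLits litC M → Lit.neg a ∈ trueLits litC M → False :=
    fun a h1 h2 => hcon.compl _ _ (h.compl_iff.2 ⟨a, hocc _ h1, hocc _ h2, rfl, rfl⟩) h1 h2
  refine ⟨⟨fun l hl => ⟨l, hocc l hl, rfl⟩, ?_, ?_⟩, ?_⟩
  · refine Set.eq_empty_of_forall_notMem ?_
    rintro l ⟨hl, k, hk, rfl⟩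
    cases k with
    | pos a => exact hcompl a hk hl
    | neg a => exact hcompl a hl hk
  · rw [P.closedUnder_iff]
    exact fun q hq hd hb => h.in_AS_of_body hN hruleId hq (hneg q hq hd) hb
  · rintro Y ⟨-, -, hY⟩ hsub l hl
    rw [P.closedUnder_iff] at hY
    obtain ⟨l', hl', he⟩ : ∃ l' ∈ Y, litC l = litC l' :=
      h.bodyMeaning hN hlitC hruleId (X := Y) (p := .in_AS) (cs := [litC l])
        (fun q hq hn hb => hY q hq (fun hd => hn (h.neg_body_false_iff.2 ⟨q, hq, rfl, hd⟩)) hb) hl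
    rwa [hlitC he]

theorem trueLits_mem_BPAS (h : IsLeastDer litC ruleId P M M) (hcon : Constraints M M)
    (hlitC : Function.Injective litC) (hruleId : Set.InjOn ruleId P.rules) :
    trueLits litC M ∈ BPAS P := by
  have hN : BodyAgree M M :=
    ⟨fun _ => Iff.rfl, fun _ _ _ => Iff.rfl, fun _ _ => Iff.rfl, fun _ _ => Iff.rfl⟩
  refine PrioritizedProgram.mem_BPAS_iff_exists_zombiesDefeated.2
    ⟨h.trueLits_mem_AS hcon hlitC hruleId, ?_⟩
  -- The constraint on `removed` provides some stage, and stages are finitely many, so there is a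
  -- first one. Outside `P` the rank is a dummy.
  have hrank : ∀ q, ∃ s, q ∈ P.rules → M .remove [ruleId q, s] ∧
      ∀ s', M .remove [ruleId q, s'] → s ≤ s' := by
    intro q
    by_cases hq : q ∈ P.rules
    · obtain ⟨s, hs⟩ := h.removed_iff.1 (hcon.removed _ (h.rule_iff.2 ⟨q, hq, rfl⟩))
      have hfin : {s | M .remove [ruleId q, s]}.Finite := by
        refine (P.finite.image ruleId).subset fun s hs => ?_
        obtain ⟨t, ht, rfl⟩ := h.stage_iff.1 (h.remove_iff.1 hs).2.1
        exact ⟨t, ht, rfl⟩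
      obtain ⟨s₀, h₀, hmin⟩ := Set.exists_min_image _ id hfin ⟨s, hs⟩
      exact ⟨s₀, fun _ => ⟨h₀, hmin⟩⟩
    · exact ⟨ruleId q, fun h => absurd h hq⟩
  choose rank hrank using hrank
  -- A rule with a predecessor is removed only because at a strictly earlier stage all its immediate
  -- predecessors were already removed.
  have hcov : ∀ r r', Covers P r r' → rank r < rank r' := by
    intro r r' hc
    obtain ⟨hr, hr'⟩ := P.lt_mem hc.1
    obtain ⟨-, -, ⟨h1, -⟩ | ⟨s, hs, hlt, hns, -⟩⟩ := h.remove_iff.1 (hrank r' hr').1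
    · exact absurd (h.nosource0_iff.2 ⟨r, r', hc, rfl⟩) h1
    · refine lt_of_le_of_lt ((hrank r hr).2 s ?_) hlt
      by_contra hrem
      exact hns (h.nosource_iff.2 ⟨h.stage_iff.1 hs, r, r', hc, rfl, hrem⟩)
  -- The tie-break by `ruleId` is immaterial: covering pairs and the defeat of zombies both give
  -- strict inequalities of ranks.
  refine ⟨P.orderBy rank ruleId, P.orderBy_mem_FP hruleId fun r r' =>
    lt_of_forall_covers P rank hcov, fun r hr hz => ?_⟩
  have hzM := (h.z_iff hN hlitC hruleId (fun _ => Iff.rfl)).2 ⟨r, hr, rfl, hz⟩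
  obtain ⟨-, -, ⟨-, h1⟩ | ⟨s, hs, hlt, hns, ⟨h1, -⟩ | ⟨-, x, hx, hsx⟩⟩⟩ :=
    h.remove_iff.1 (hrank r hr).1
  · exact absurd hzM h1
  · exact absurd hzM h1
  · obtain ⟨q, hq, hrem, hg, l, hl, rfl⟩ := (h.s_iff hN hlitC hruleId (fun _ => Iff.rfl)).1 hsx
    obtain ⟨r', hr', l', hl', he, hk⟩ := h.nbl_iff.1 hx
    obtain rfl := hruleId hr hr' hk
    obtain rfl := hlitC he
    exact ⟨q, ⟨hq, hr, Or.inl (((hrank q hq).2 s hrem).trans_lt hlt)⟩, hg, l, hl, hl'⟩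

end IsLeastDer

end Soundness

/-! ### From B-preferred answer sets to meta answer sets. -/

section Completeness

variable {α K : Type*} [LinearOrder K]
variable {litC : Lit α → K} {ruleId : Rule α → K} {P : PrioritizedProgram α}
variable {N N' T : MetaPred → List K → Prop} {A : Set (Lit α)}

/-- The two sets of atoms agree on all predicates that occur default-negated in the rules of the
meta-program. -/
structure NegAgree (N T : MetaPred → List K → Prop) : Prop extends BodyAgree N T where
  neg_body_false : ∀ k, N .neg_body_false [k] ↔ T .neg_body_false [k]
  in_AS : ∀ x, N .in_AS [x] ↔ T .in_AS [x]
  nosource0 : ∀ k, N .nosource0 [k] ↔ T .nosource0 [k]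
  z : ∀ k, N .z [k] ↔ T .z [k]
  nosource : ∀ k s, N .nosource [k, s] ↔ T .nosource [k, s]
  remove : ∀ k s, N .remove [k, s] ↔ T .remove [k, s]

theorem Der.congr_neg (h : NegAgree N N') {p : MetaPred} {cs : List K} :
    Der litC ruleId P N T p cs ↔ Der litC ruleId P N' T p cs := by
  suffices H : ∀ {N N' : MetaPred → List K → Prop}, NegAgree N N' →
      Der litC ruleId P N T p cs → Der litC ruleId P N' T p cs from
    ⟨H h, H ⟨⟨fun _ => (h.pos_body_exists _).symm, fun _ _ _ => (h.pbl_inbetween _ _ _).symm,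
      fun _ _ => (h.pbl_notlast _ _).symm, fun _ _ => (h.pbl_notfirst _ _).symm⟩,
      fun _ => (h.neg_body_false _).symm, fun _ => (h.in_AS _).symm,
      fun _ => (h.nosource0 _).symm, fun _ => (h.z _).symm, fun _ _ => (h.nosource _ _).symm,
      fun _ _ => (h.remove _ _).symm⟩⟩
  intro N N' h hd
  cases hd with
  | rule h => exact .rule h
  | head h => exact .head h
  | pbl h => exact .pbl h
  | nbl h => exact .nbl h
  | compl h => exact .compl h
  | pr h => exact .pr h
  | in_AS h1 h2 h3 => exact .in_AS h1 h2 (by rwa [← h.neg_body_false])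
  | pos_body_exists h => exact .pos_body_exists h
  | pos_body_true_empty h1 h2 => exact .pos_body_true_empty h1 (by rwa [← h.pos_body_exists])
  | pbl_inbetween h1 h2 h3 h4 h5 => exact .pbl_inbetween h1 h2 h3 h4 h5
  | pbl_notlast h1 h2 h3 => exact .pbl_notlast h1 h2 h3
  | pbl_notfirst h1 h2 h3 => exact .pbl_notfirst h1 h2 h3
  | upto_first h1 h2 h3 => exact .upto_first h1 h2 (by rwa [← h.pbl_notfirst])
  | upto_next h1 h2 h3 h4 h5 => exact .upto_next h1 h2 h3 (by rwa [← h.pbl_inbetween]) h5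
  | pos_body_true_last h1 h2 => exact .pos_body_true_last h1 (by rwa [← h.pbl_notlast])
  | neg_body_false h1 h2 => exact .neg_body_false h1 h2
  | g h1 h2 h3 => exact .g h1 h2 (by rwa [← h.neg_body_false])
  | z h1 h2 h3 h4 => exact .z h1 h2 h3 (by rwa [← h.in_AS])
  | stage h => exact .stage h
  | nosource0 h => exact .nosource0 h
  | remove_source h1 h2 h3 h4 =>
    exact .remove_source h1 h2 (by rwa [← h.nosource0]) (by rwa [← h.z])
  | nosource h1 h2 h3 => exact .nosource h1 h2 (by rwa [← h.remove])
  | remove_next h1 h2 h3 h4 h5 h6 h7 =>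
    exact .remove_next h1 h2 h3 (by rwa [← h.nosource]) (by rwa [← h.z]) (by rwa [← h.remove]) h7
  | remove_zombie h1 h2 h3 h4 h5 h6 h7 h8 =>
    exact .remove_zombie h1 h2 h3 h4 h5 h6 (by rwa [← h.nosource]) h8
  | s h1 h2 h3 => exact .s h1 h2 h3
  | removed h => exact .removed h

theorem IsLeastDer.congr_neg (h : NegAgree N N') (hT : IsLeastDer litC ruleId P N T) :
    IsLeastDer litC ruleId P N' T :=
  ⟨fun p cs hd => hT.closed p cs ((Der.congr_neg h).2 hd),
    fun U hU => hT.least U fun p cs hd => hU p cs ((Der.congr_neg h).1 hd)⟩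

theorem exists_isLeastDer (litC : Lit α → K) (ruleId : Rule α → K) (P : PrioritizedProgram α)
    (N : MetaPred → List K → Prop) : ∃ T, IsLeastDer litC ruleId P N T :=
  ⟨fun p cs => ∀ U, DerClosed litC ruleId P N U → U p cs,
    fun p cs hd U hU => hU p cs (hd.mono fun _ _ h => h U hU), fun U hU _ _ h => h U hU⟩

/-- `Removal ruleId P A q s`: the rule `q` is removed at stage `s` of the graph-based check
for `A`. -/
inductive Removal (ruleId : Rule α → K) (P : PrioritizedProgram α) (A : Set (Lit α)) :
    Rule α → K → Prop
  | source {q : Rule α} {s : K} : q ∈ P.rules → s ∈ ruleId '' P.rules →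
      (∀ q', ¬ Covers P q' q) → ¬ Zombie A q → Removal ruleId P A q s
  | next {q : Rule α} {s s' : K} : q ∈ P.rules → s ∈ ruleId '' P.rules → s' ∈ ruleId '' P.rules →
      (∀ q', Covers P q' q → Removal ruleId P A q' s) → ¬ Zombie A q → s < s' →
      Removal ruleId P A q s'
  | zombie {q t : Rule α} {s s' : K} : q ∈ P.rules → s ∈ ruleId '' P.rules →
      s' ∈ ruleId '' P.rules → (∀ q', Covers P q' q → Removal ruleId P A q' s) → Zombie A q →
      Removal ruleId P A t s → Generating A t → (t.H ∩ q.Bneg).Nonempty → s < s' →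
      Removal ruleId P A q s'

theorem Removal.mem {q : Rule α} {s : K} (h : Removal ruleId P A q s) :
    q ∈ P.rules ∧ s ∈ ruleId '' P.rules := by
  cases h <;> exact ⟨by assumption, by assumption⟩

/-- `Removal` omits the premise `not remove(R,S)` of the meta-rule, so that it is a positive
induction. This recovers the premise: descending through the stages reaches either a source or a
stage at which the predecessors are gone but `q` is still present. -/
theorem Removal.exists_first {q : Rule α} {s' : K} (h : Removal ruleId P A q s')
    (hq : ¬ Zombie A q) : (∀ q', ¬ Covers P q' q) ∨
      ∃ s ∈ ruleId '' P.rules, s < s' ∧ (∀ q', Covers P q' q → Removal ruleId P A q' s) ∧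
        ¬ Removal ruleId P A q s := by
  have hfin : (ruleId '' P.rules).Finite := P.finite.image _
  refine (hfin.wellFoundedOn (r := (· < ·))).induction h.mem.2
    (P := fun s' => Removal ruleId P A q s' → (∀ q', ¬ Covers P q' q) ∨
      ∃ s ∈ ruleId '' P.rules, s < s' ∧ (∀ q', Covers P q' q → Removal ruleId P A q' s) ∧
        ¬ Removal ruleId P A q s) (fun s' hs' ih h => ?_) h
  cases h with
  | source _ _ h _ => exact Or.inl h
  | @next _ s _ _ hs _ hc _ hlt =>
    by_cases hr : Removal ruleId P A q s
    · rcases ih s hs hlt hr with h | ⟨t, ht, hts, h⟩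
      · exact Or.inl h
      · exact Or.inr ⟨t, ht, hts.trans hlt, h⟩
    · exact Or.inr ⟨s, hs, hlt, hc, hr⟩
  | zombie _ _ _ _ hz => exact absurd hz hq

/-- The names of the positive body literals of the rule named `k`. -/
def IsPosBodyName (litC : Lit α → K) (ruleId : Rule α → K) (P : PrioritizedProgram α)
    (x k : K) : Prop :=
  ∃ q ∈ P.rules, ∃ l ∈ q.Bpos, x = litC l ∧ k = ruleId q

/-- The intended meaning for `A` of the default-negated predicates of the meta-program and of
`s`. -/
def intended (litC : Lit α → K) (ruleId : Rule α → K) (P : PrioritizedProgram α)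
    (A : Set (Lit α)) : MetaPred → List K → Prop
  | .pos_body_exists, [k] => ∃ q ∈ P.rules, k = ruleId q ∧ q.Bpos.Nonempty
  | .pbl_inbetween, [x, y, k] => IsPosBodyName litC ruleId P x k ∧ IsPosBodyName litC ruleId P y k ∧
      ∃ z, IsPosBodyName litC ruleId P z k ∧ x < z ∧ z < y
  | .pbl_notlast, [x, k] =>
    IsPosBodyName litC ruleId P x k ∧ ∃ y, IsPosBodyName litC ruleId P y k ∧ x < y
  | .pbl_notfirst, [x, k] =>
    IsPosBodyName litC ruleId P x k ∧ ∃ y, IsPosBodyName litC ruleId P y k ∧ y < x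
  | .neg_body_false, [k] => ∃ q ∈ P.rules, k = ruleId q ∧ q.DefeatedBy A
  | .in_AS, [x] => ∃ l ∈ A, x = litC l
  | .nosource0, [k] => ∃ q q', Covers P q q' ∧ k = ruleId q'
  | .z, [k] => ∃ q ∈ P.rules, k = ruleId q ∧ Zombie A q
  | .remove, [k, s] => ∃ q ∈ P.rules, k = ruleId q ∧ Removal ruleId P A q s
  | .nosource, [k, s] => (∃ q ∈ P.rules, s = ruleId q) ∧ ∃ q q', Covers P q q' ∧ k = ruleId q' ∧
      ¬ ∃ q' ∈ P.rules, ruleId q = ruleId q' ∧ Removal ruleId P A q' s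
  | .s, [x, s] => ∃ q ∈ P.rules, Removal ruleId P A q s ∧ Generating A q ∧ ∃ l ∈ q.H, x = litC l
  | _, _ => False

namespace IsLeastDer

theorem bodyAgree_intended (h : IsLeastDer litC ruleId P (intended litC ruleId P A) T) :
    BodyAgree (intended litC ruleId P A) T where
  pos_body_exists k := by rw [h.pos_body_exists_iff, intended]
  pbl_inbetween x y k := by simp only [h.pbl_inbetween_iff, h.pbl_iff, intended, IsPosBodyName]
  pbl_notlast x k := by simp only [h.pbl_notlast_iff, h.pbl_iff, intended, IsPosBodyName]
  pbl_notfirst x k := by simp only [h.pbl_notfirst_iff, h.pbl_iff, intended, IsPosBodyName]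

/-- Bounded above since `A` is closed under its own reduct, and below since `A` is the least such
set. -/
theorem trueLits_eq (h : IsLeastDer litC ruleId P (intended litC ruleId P A) T)
    (hlitC : Function.Injective litC) (hruleId : Set.InjOn ruleId P.rules)
    (hA : A ∈ AS P.rules) : trueLits litC T = A := by
  have hN := h.bodyAgree_intended
  apply Set.Subset.antisymm
  · intro l hl
    obtain ⟨l', hl', he⟩ : ∃ l' ∈ A, litC l = litC l' :=
      h.bodyMeaning hN hlitC hruleId (X := A) (p := .in_AS) (cs := [litC l])
        (fun q hq hn hb => P.H_subset_of_generating hA hq ⟨hb, fun hd => hn ⟨q, hq, rfl, hd⟩⟩) hl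
    rwa [hlitC he]
  · refine P.subset_of_closed hA fun q hq hd _ hb _ => h.in_AS_of_body hN hruleId hq ?_ hb
    rintro ⟨q', hq', hk, hd'⟩
    obtain rfl := hruleId hq hq' hk
    exact hd hd'

theorem removal_of_remove (h : IsLeastDer litC ruleId P (intended litC ruleId P A) T)
    (hlitC : Function.Injective litC) (hruleId : Set.InjOn ruleId P.rules)
    (hA : A ∈ AS P.rules) {k s : K} (hr : T .remove [k, s]) :
    ∃ q ∈ P.rules, k = ruleId q ∧ Removal ruleId P A q s := by
  have hN := h.bodyAgree_intended
  have heq := h.trueLits_eq hlitC hruleId hA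
  have hin : ∀ x, intended litC ruleId P A .in_AS [x] ↔ T .in_AS [x] := by
    intro x
    rw [h.in_AS_iff, heq, intended]
  have hneg : ∀ k, intended litC ruleId P A .neg_body_false [k] ↔ T .neg_body_false [k] := by
    intro x
    rw [h.neg_body_false_iff, heq, intended]
  have hcov : ∀ {q : Rule α} {s : K}, T .stage [s] →
      ¬ intended litC ruleId P A .nosource [ruleId q, s] →
      ∀ q', Covers P q' q → Removal ruleId P A q' s := by
    intro q s hs hns q' hc
    by_contra hrem
    refine hns ⟨h.stage_iff.1 hs, q', q, hc, rfl, ?_⟩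
    rintro ⟨q'', hq'', hk, hrem'⟩
    obtain rfl := hruleId (P.lt_mem hc.1).1 hq'' hk
    exact hrem hrem'
  have hst : ∀ {s : K}, T .stage [s] → s ∈ ruleId '' P.rules := by
    intro s hs
    obtain ⟨q, hq, rfl⟩ := h.stage_iff.1 hs
    exact ⟨q, hq, rfl⟩
  -- `remove` and `s` depend positively on each other, so they are handled in one induction; other
  -- predicates are left unconstrained.
  let φ : MetaPred → List K → Prop := fun p cs =>
    (p = .remove ∨ p = .s) → intended litC ruleId P A p cs
  refine h.induct φ (fun p cs hd => ?_) hr (Or.inl rfl)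
  cases hd with
  | remove_source h1 h2 h3 h4 =>
    obtain ⟨q, hq, rfl⟩ := h.rule_iff.1 h1.1
    exact fun _ => ⟨q, hq, rfl, .source hq (hst h2.1) (fun q' hc => h3 ⟨q', q, hc, rfl⟩)
      fun hz => h4 ⟨q, hq, rfl, hz⟩⟩
  | remove_next h1 h2 h3 h4 h5 h6 h7 =>
    obtain ⟨q, hq, rfl⟩ := h.rule_iff.1 h1.1
    exact fun _ => ⟨q, hq, rfl, .next hq (hst h2.1) (hst h3.1) (hcov h2.1 h4)
      (fun hz => h5 ⟨q, hq, rfl, hz⟩) h7⟩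
  | remove_zombie h1 h2 h3 h4 h5 h6 h7 h8 =>
    obtain ⟨q, hq, rfl, hz⟩ := (h.z_iff hN hlitC hruleId hin).1 h4.1
    obtain ⟨q', hq', l, hl, rfl, hk⟩ := h.nbl_iff.1 h5.1
    obtain rfl := hruleId hq hq' hk
    obtain ⟨t, ht, hrem, hg, l', hl', he⟩ := h6.2 (Or.inr rfl)
    obtain rfl := hlitC he
    rw [heq] at hz
    exact fun _ => ⟨q, hq, rfl, .zombie hq (hst h2.1) (hst h3.1) (hcov h2.1 h7) hz hrem hg
      ⟨l, hl', hl⟩ h8⟩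
  | s h1 h2 h3 =>
    obtain ⟨q, hq, rfl, hrem⟩ := h1.2 (Or.inl rfl)
    obtain ⟨q', hq', hk, hg⟩ := (h.g_iff hN hlitC hruleId hneg).1 h2.1
    obtain rfl := hruleId hq hq' hk
    obtain ⟨q', hq', l, hl, rfl, hk⟩ := h.head_iff.1 h3.1
    obtain rfl := hruleId hq hq' hk
    rw [heq] at hg
    exact fun _ => ⟨q, hq, hrem, hg, l, hl, rfl⟩
  | _ => exact fun h => by simp at h

theorem remove_of_removal (h : IsLeastDer litC ruleId P (intended litC ruleId P A) T)
    (hlitC : Function.Injective litC) (hruleId : Set.InjOn ruleId P.rules)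
    (hA : A ∈ AS P.rules) {q : Rule α} {s : K} (hr : Removal ruleId P A q s) :
    T .remove [ruleId q, s] := by
  have hN := h.bodyAgree_intended
  have heq := h.trueLits_eq hlitC hruleId hA
  have hin : ∀ x, intended litC ruleId P A .in_AS [x] ↔ T .in_AS [x] := by
    intro x
    rw [h.in_AS_iff, heq, intended]
  have hneg : ∀ k, intended litC ruleId P A .neg_body_false [k] ↔ T .neg_body_false [k] := by
    intro x
    rw [h.neg_body_false_iff, heq, intended]
  have hrule : ∀ {q : Rule α}, q ∈ P.rules → T .rule [ruleId q] :=
    fun hq => h.rule_iff.2 ⟨_, hq, rfl⟩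
  have hst : ∀ {s : K}, s ∈ ruleId '' P.rules → T .stage [s] := by
    rintro _ ⟨t, ht, rfl⟩
    exact h.stage_iff.2 ⟨t, ht, rfl⟩
  have hns0 : ∀ {q : Rule α}, q ∈ P.rules → (∀ q', ¬ Covers P q' q) →
      ¬ intended litC ruleId P A .nosource0 [ruleId q] := by
    rintro q hq hc ⟨q', q'', hc', hk⟩
    obtain rfl := hruleId hq (P.lt_mem hc'.1).2 hk
    exact hc q' hc'
  have hns : ∀ {q : Rule α} {s : K}, q ∈ P.rules → (∀ q', Covers P q' q → Removal ruleId P A q' s) →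
      ¬ intended litC ruleId P A .nosource [ruleId q, s] := by
    rintro q s hq hc ⟨-, q', q'', hc', hk, hrem⟩
    obtain rfl := hruleId hq (P.lt_mem hc'.1).2 hk
    exact hrem ⟨q', (P.lt_mem hc'.1).1, rfl, hc q' hc'⟩
  have hz : ∀ {q : Rule α}, q ∈ P.rules → ¬ Zombie A q →
      ¬ intended litC ruleId P A .z [ruleId q] := by
    rintro q hq hz ⟨q', hq', hk, hz'⟩
    obtain rfl := hruleId hq hq' hk
    exact hz hz'
  -- For non-zombies the meta-rules refer to earlier removals only under negation, hence through
  -- `intended`, so no induction hypothesis is needed. Zombies need it for the atom `s`.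
  have key : ∀ {q : Rule α} {s : K}, Removal ruleId P A q s → ¬ Zombie A q →
      T .remove [ruleId q, s] := by
    intro q s hr hzq
    obtain ⟨hq, hs⟩ := hr.mem
    rcases hr.exists_first hzq with hc | ⟨t, ht, hlt, hc, hn⟩
    · exact h.closed _ _ (.remove_source (hrule hq) (hst hs) (hns0 hq hc) (hz hq hzq))
    · refine h.closed _ _ (.remove_next (hrule hq) (hst ht) (hst hs) (hns hq hc) (hz hq hzq) ?_ hlt)
      rintro ⟨q', hq', hk, hr'⟩
      obtain rfl := hruleId hq hq' hk
      exact hn hr'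
  induction hr with
  | source h1 h2 h3 h4 => exact key (.source h1 h2 h3 h4) h4
  | next h1 h2 h3 h4 h5 h6 => exact key (.next h1 h2 h3 h4 h5 h6) h5
  | zombie h1 h2 h3 h4 h5 h6 h7 h8 h9 _ ih =>
    obtain ⟨l, hl, hlq⟩ := h8
    refine h.closed _ _ (.remove_zombie (hrule h1) (hst h2) (hst h3)
      ((h.z_iff hN hlitC hruleId hin).2 ⟨_, h1, rfl, by rwa [heq]⟩)
      (h.nbl_iff.2 ⟨_, h1, l, hlq, rfl, rfl⟩)
      ((h.s_iff hN hlitC hruleId hneg).2 ⟨_, h6.mem.1, ih, by rwa [heq], l, hl, rfl⟩)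
      (hns h1 h4) h9)

theorem negAgree_intended (h : IsLeastDer litC ruleId P (intended litC ruleId P A) T)
    (hlitC : Function.Injective litC) (hruleId : Set.InjOn ruleId P.rules)
    (hA : A ∈ AS P.rules) : NegAgree (intended litC ruleId P A) T where
  toBodyAgree := h.bodyAgree_intended
  neg_body_false k := by
    rw [h.neg_body_false_iff, h.trueLits_eq hlitC hruleId hA, intended]
  in_AS x := by
    rw [h.in_AS_iff, h.trueLits_eq hlitC hruleId hA, intended]
  nosource0 k := by rw [h.nosource0_iff, intended]
  z k := by
    rw [h.z_iff h.bodyAgree_intended hlitC hruleId, h.trueLits_eq hlitC hruleId hA, intended]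
    intro x
    rw [h.in_AS_iff, h.trueLits_eq hlitC hruleId hA, intended]
  nosource k s := h.nosource_iff.symm
  remove k s := by
    constructor
    · rintro ⟨q, -, rfl, hr⟩
      exact h.remove_of_removal hlitC hruleId hA hr
    · exact h.removal_of_remove hlitC hruleId hA

end IsLeastDer

/-- Rules can be removed in the order of `Q`: the predecessors of a rule in `P`, and for a zombie
its defeating generating rule, have smaller position in `Q`. -/
theorem exists_removal (hruleId : Set.InjOn ruleId P.rules) {Q : PrioritizedProgram α}
    (hQ : Q ∈ P.FP) (hz : ZombiesDefeated Q A) {r : Rule α} (hr : r ∈ P.rules) :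
    ∃ s, Removal ruleId P A r s := by
  classical
  obtain ⟨hrules, -, hlt⟩ := hQ
  have hfin : (ruleId '' P.rules).Finite := P.finite.image _
  have hcard : hfin.toFinset.card = P.rules.ncard := by
    rw [← Set.ncard_eq_toFinset_card _ hfin, hruleId.ncard_image]
  -- The stages in increasing order; injectivity of `ruleId` on `P` makes them as many as the rules.
  let st := hfin.toFinset.orderEmbOfFin hcard
  have hst : ∀ i, st i ∈ ruleId '' P.rules := fun i => by
    have := hfin.toFinset.orderEmbOfFin_mem hcard i
    rwa [Set.Finite.mem_toFinset] at this
  suffices H : ∀ (i : ℕ) (hi : i < P.rules.ncard), ∀ r ∈ P.rules, Q.position r ≤ i →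
      Removal ruleId P A r (st ⟨i, hi⟩) by
    have hpos := Q.position_lt_ncard (hrules ▸ hr)
    rw [hrules] at hpos
    exact ⟨_, H _ hpos r hr le_rfl⟩
  intro i
  induction i with
  | zero =>
    intro hi r hr hle
    -- The first rule of `Q` has no predecessor, so it is a source, and it cannot be a zombie
    -- because nothing could defeat it.
    refine .source hr (hst _) (fun q hc => ?_) fun hzr => ?_
    · have := Q.position_lt (hlt _ _ hc.1)
      omega
    · obtain ⟨q, hq, -⟩ := hz r (hrules ▸ hr) hzr
      have := Q.position_lt hq
      omega
  | succ i ih =>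
    intro hi r hr hle
    have hcov : ∀ q, Covers P q r → Removal ruleId P A q (st ⟨i, by omega⟩) := by
      intro q hc
      have := Q.position_lt (hlt _ _ hc.1)
      exact ih _ q (P.lt_mem hc.1).1 (by omega)
    have hlt' : st ⟨i, by omega⟩ < st ⟨i + 1, hi⟩ := st.strictMono (by simp)
    by_cases hzr : Zombie A r
    · obtain ⟨q, hq, hg, hn⟩ := hz r (hrules ▸ hr) hzr
      have := Q.position_lt hq
      exact .zombie hr (hst _) (hst _) hcov hzr
        (ih _ q (hrules ▸ (Q.lt_mem hq).1) (by omega)) hg hn hlt'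
    · exact .next hr (hst _) (hst _) hcov hzr hlt'

theorem exists_isLeastDer_of_mem_BPAS (hlitC : Function.Injective litC)
    (hruleId : Set.InjOn ruleId P.rules) (hA : A ∈ BPAS P) :
    ∃ M, IsLeastDer litC ruleId P M M ∧ Constraints M M ∧ trueLits litC M = A := by
  obtain ⟨hAS, Q, hQ, hz⟩ := PrioritizedProgram.mem_BPAS_iff_exists_zombiesDefeated.1 hA
  obtain ⟨M, hM⟩ := exists_isLeastDer litC ruleId P (intended litC ruleId P A)
  have heq := hM.trueLits_eq hlitC hruleId hAS
  refine ⟨M, hM.congr_neg (hM.negAgree_intended hlitC hruleId hAS), ⟨?_, ?_⟩, heq⟩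
  · intro x y h1 h2 h3
    obtain ⟨a, -, -, rfl, rfl⟩ := hM.compl_iff.1 h1
    have h2' : Lit.pos a ∈ A := heq ▸ h2
    have h3' : Lit.neg a ∈ A := heq ▸ h3
    have : Lit.pos a ∈ A ∩ Lit.compl '' A := ⟨h2', _, h3', rfl⟩
    rw [hAS.1.2.1] at this
    exact this
  · intro k hk
    obtain ⟨q, hq, rfl⟩ := hM.rule_iff.1 hk
    obtain ⟨s, hs⟩ := exists_removal hruleId hQ hz hq
    exact hM.removed_iff.2 ⟨s, hM.remove_of_removal hlitC hruleId hAS hs⟩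

end Completeness

end MetaASP

theorem theorem3 {α K : Type*} [Nonempty K] [LinearOrder K]
    (P : MetaASP.PrioritizedProgram α)
    (litC : MetaASP.Lit α → K) (hlitC : Function.Injective litC)
    (ruleId : MetaASP.Rule α → K) (hruleId : Set.InjOn ruleId P.rules) :
    (∀ A ∈ MetaASP.foAS (MetaASP.PIg ∪ MetaASP.facts litC ruleId P),
      MetaASP.proj litC A ∈ MetaASP.BPAS P) ∧
    (∀ A ∈ MetaASP.BPAS P,
      ∃ A' ∈ MetaASP.foAS (MetaASP.PIg ∪ MetaASP.facts litC ruleId P),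
        MetaASP.proj litC A' = A) := by
  constructor
  · intro A hA
    obtain ⟨-, hM, hcon⟩ := MetaASP.mem_foAS_iff.1 hA
    exact hM.trueLits_mem_BPAS hcon hlitC hruleId
  · intro A hA
    obtain ⟨M, hM, hcon, heq⟩ := MetaASP.exists_isLeastDer_of_mem_BPAS hlitC hruleId hA
    refine ⟨MetaASP.posLits M, ?_, heq ▸ ?_⟩
    · rw [MetaASP.mem_foAS_iff, MetaASP.holds_posLits]
      exact ⟨subset_rfl, hM, hcon⟩
    · ext l
      exact Iff.of_eq (congrFun₂ (MetaASP.holds_posLits M) _ _)
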